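/- Call a $p$-tuple $a=(a_1,\dots,a_p)$ primitive if the $a_i$ are distinct positive integers with $\gcd(a_1,\dots,a_p)=1$, and divisible if $a_i \mid a_{i+1}$ for $i=1,\dots,p-1$. For a primitive $a$ let $F(a)$ be its Frobenius number, the largest nonnegative integer that is not a nonnegative integer combination of the $a_i$, with the convention $F(a)=0$ if there is none (that is, if some $a_i=1$). An independence system is a nonempty set $S\subseteq\{0,1\}^n$ such that $x\in\{0,1\}^n$, $x\le y\in S$ imply $x\in S$. For $w\in\mathbb Z^n$ and $f:\mathbb Z\to\mathbb R$, an $r$-best solution of $\min\{f(w^\top x): x\in S\}$ is an $x^*\in S$ such that at most $r$ objective values strictly smaller than $f(w^\top x^*)$ are attained on $S$. Then one can assign to every $p\ge 1$ and every primitive $p$-tuple $a$ a nonnegative integer constant $r(a)$ such that there is an algorithm (depending only on $a$) that, given any $n$, any independence system $S\subseteq\{0,1\}^n$ presented by a linear-optimization oracle (which on $c\in\mathbb Z^n$ returns some $x\in S$ maximizing $c^\top x$ over $S$), any weight vector $w\in\{a_1,\dots,a_p\}^n$, and any function $f:\mathbb Z\to\mathbb R$ presented by a comparison oracle (which on $u,v\in\mathbb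 Z$ tells whether $f(u)\le f(v)$), provides an $r(a)$-best solution of $\min\{f(w^\top x): x\in S\}$ in time polynomial in $n$, and such that the following hold: 1. $r(a)\le (2\max(a))^p$. 2. If $a$ is divisible, then $r(a)=0$. 3. If $p=2$, then $r(a)=F(a)$. -/

import Mathlib

/-! ### Tuples of weights -/

/-- A `p`-tuple is primitive if its entries are distinct positive integers with gcd `1`. -/
structure IsPrimitiveTuple {p : ℕ} (a : Fin p → ℕ) : Prop where
  injective : Function.Injective a
  pos : ∀ i, 0 < a i
  gcd_eq_one : Finset.univ.gcd a = 1

/-- A tuple is divisible if each entry divides the next one. -/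
def IsDivisibleTuple {p : ℕ} (a : Fin p → ℕ) : Prop :=
  ∀ i j : Fin p, (j : ℕ) = (i : ℕ) + 1 → a i ∣ a j

/-- The natural numbers that are not nonnegative integer combinations of the entries of `a`. -/
def gapSet {p : ℕ} (a : Fin p → ℕ) : Set ℕ :=
  {v | ¬ ∃ c : Fin p → ℕ, v = ∑ i, c i * a i}

/-- The Frobenius number: the largest element of the (finite, for primitive `a`) gap set, with the
usual convention that it is `0` when there is no gap, that is, when `1` is an entry of `a`. -/
noncomputable def frobeniusNum {p : ℕ} (a : Fin p → ℕ) : ℕ := sSup (gapSet a)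

/-- Where Mathlib's Frobenius number exists, this is it. -/
theorem frobeniusNum_eq {p : ℕ} (a : Fin p → ℕ) (k : ℕ) (h : FrobeniusNumber k (Set.range a)) :
    frobeniusNum a = k := by
  have e : gapSet a = {k | k ∉ AddSubmonoid.closure (Set.range a)} := by
    ext v
    refine not_congr ⟨?_, fun hv => ?_⟩
    · rintro ⟨c, rfl⟩
      exact sum_mem fun i _ => by
        rw [← smul_eq_mul]; exact nsmul_mem (AddSubmonoid.subset_closure (Set.mem_range_self i)) (c i)
    · induction hv using AddSubmonoid.closure_induction with
      | mem x hx =>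
        obtain ⟨i, rfl⟩ := hx
        exact ⟨Pi.single i 1, by simp [Pi.single_apply]⟩
      | zero => exact ⟨0, by simp⟩
      | add x y _ _ hx hy =>
        obtain ⟨c, rfl⟩ := hx
        obtain ⟨d, rfl⟩ := hy
        exact ⟨c + d, by simp [add_mul, Finset.sum_add_distrib]⟩
  rw [frobeniusNum, e]
  exact h.csSup_eq

/-- The maximum entry of a tuple. -/
def maxEntry {p : ℕ} (a : Fin p → ℕ) : ℕ := Finset.univ.sup a

/-! ### The optimization problem -/

/-- `x` is a vector in `{0,1}^n`. -/
def IsZeroOne {n : ℕ} (x : Fin n → ℤ) : Prop := ∀ j, x j = 0 ∨ x j = 1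

/-- An independence system: a nonempty set of `0/1` vectors that is closed downwards. -/
structure IsIndependenceSystem {n : ℕ} (S : Set (Fin n → ℤ)) : Prop where
  nonempty : S.Nonempty
  zeroOne : ∀ x ∈ S, IsZeroOne x
  down_closed : ∀ x y : Fin n → ℤ, IsZeroOne x → x ≤ y → y ∈ S → x ∈ S

/-- The total weight `wᵀ x`. -/
def totalWeight {n : ℕ} (w x : Fin n → ℤ) : ℤ := ∑ j, w j * x j

/-- `x` is an `r`-best solution of `min {f (wᵀ y) : y ∈ S}`: it is feasible, and at most `r` better
objective values are attained by feasible solutions. -/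
def IsBestSolution {n : ℕ} (r : ℕ) (S : Set (Fin n → ℤ)) (w : Fin n → ℤ) (f : ℤ → ℝ)
    (x : Fin n → ℤ) : Prop :=
  x ∈ S ∧
    {v : ℝ | (∃ y ∈ S, f (totalWeight w y) = v) ∧ v < f (totalWeight w x)}.encard ≤ r

/-- `lin` answers every `c ∈ ℤⁿ` with an element of `S` that maximizes `cᵀ x` over `S`. -/
def IsLinearOptimizationOracle {n : ℕ} (S : Set (Fin n → ℤ))
    (lin : (Fin n → ℤ) → (Fin n → ℤ)) : Prop :=
  ∀ c, lin c ∈ S ∧ ∀ x ∈ S, totalWeight c x ≤ totalWeight c (lin c)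

/-- `cmp` answers every pair `u, v` with whether `f u ≤ f v`. -/
def IsComparisonOracle (f : ℤ → ℝ) (cmp : ℤ → ℤ → Bool) : Prop :=
  ∀ u v, cmp u v = true ↔ f u ≤ f v

/-! ### Oracle algorithms

Algorithms are finite programs for a random access machine with integer registers `0, 1, 2, …` and
integer arrays `0, 1, 2, …`. The only arithmetic operations are addition and subtraction (no
multiplication), so that the number of steps under unit cost is polynomially related to the running
time of a Turing machine. -/

/-- Programs. Lower case letters are registers, upper case letters are arrays. -/
inductive OracleProgram : Type
  /-- Do nothing. -/
  | skip
  /-- `x := k` for an integer constant `k`. -/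
  | const (x : ℕ) (k : ℤ)
  /-- `x := y + z`. -/
  | plus (x y z : ℕ)
  /-- `x := y - z`. -/
  | minus (x y z : ℕ)
  /-- `x := A[y]`. -/
  | load (x A y : ℕ)
  /-- `A[y] := x`. -/
  | store (A y x : ℕ)
  /-- First the one program, then the other. -/
  | seq (P Q : OracleProgram)
  /-- If `0 < x` then `P`, else `Q`. -/
  | branch (x : ℕ) (P Q : OracleProgram)
  /-- While `0 < x` do `P`. -/
  | loop (x : ℕ) (P : OracleProgram)
  /-- Ask the comparison oracle about `y, z`; set `x` to `1` or `0` if it says yes or no. -/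
  | compare (x y z : ℕ)
  /-- Ask the linear-optimization oracle about the vector in the first `n` entries of `C`, and
  write its answer to the first `n` entries of `X`. -/
  | linopt (X C : ℕ)

/-- The contents of the memory. -/
structure MachineState : Type where
  reg : ℕ → ℤ
  arr : ℕ → ℤ → ℤ

namespace MachineState

/-- Write `v` to register `x`. -/
def setReg (s : MachineState) (x : ℕ) (v : ℤ) : MachineState :=
  { s with reg := Function.update s.reg x v }

/-- Write `v` to entry `i` of array `A`. -/
def setEntry (s : MachineState) (A : ℕ) (i v : ℤ) : MachineState :=
  { s with arr := Function.update s.arr A (Function.update (s.arr A) i v) }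

/-- The vector in the entries `0, …, n - 1` of array `A`. -/
def getVec (s : MachineState) (n A : ℕ) : Fin n → ℤ := fun j => s.arr A ((j : ℕ) : ℤ)

/-- Write the vector `x` to the entries `0, …, n - 1` of array `A`. -/
def setVec (s : MachineState) {n : ℕ} (A : ℕ) (x : Fin n → ℤ) : MachineState :=
  { s with arr := Function.update s.arr A fun i =>
      if h : 0 ≤ i ∧ i.toNat < n then x ⟨i.toNat, h.2⟩ else s.arr A i }

/-- The initial memory: `n` in register `0`, the vector `w` in array `0`, and `0` elsewhere. -/
def init {n : ℕ} (w : Fin n → ℤ) : MachineState :=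
  (MachineState.mk (Function.update (fun _ => 0) 0 (n : ℤ)) (fun _ _ => 0)).setVec 0 w

end MachineState

/-- `Runs lin cmp P s t s'`: with the given oracles, program `P` started in the memory `s` halts
after `t` steps with the memory `s'`. A call of the linear-optimization oracle takes `n + 1` steps,
every other operation and every test takes one step. -/
inductive Runs {n : ℕ} (lin : (Fin n → ℤ) → (Fin n → ℤ)) (cmp : ℤ → ℤ → Bool) :
    OracleProgram → MachineState → ℕ → MachineState → Prop
  | skip (s) : Runs lin cmp .skip s 1 s
  | const (x k s) : Runs lin cmp (.const x k) s 1 (s.setReg x k)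
  | plus (x y z s) : Runs lin cmp (.plus x y z) s 1 (s.setReg x (s.reg y + s.reg z))
  | minus (x y z s) : Runs lin cmp (.minus x y z) s 1 (s.setReg x (s.reg y - s.reg z))
  | load (x A y s) : Runs lin cmp (.load x A y) s 1 (s.setReg x (s.arr A (s.reg y)))
  | store (A y x s) : Runs lin cmp (.store A y x) s 1 (s.setEntry A (s.reg y) (s.reg x))
  | seq {P Q s t s' t' s''} : Runs lin cmp P s t s' → Runs lin cmp Q s' t' s'' →
      Runs lin cmp (.seq P Q) s (t + t') s''
  | branch_pos {x P Q s t s'} : 0 < s.reg x → Runs lin cmp P s t s' →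
      Runs lin cmp (.branch x P Q) s (t + 1) s'
  | branch_neg {x P Q s t s'} : ¬ 0 < s.reg x → Runs lin cmp Q s t s' →
      Runs lin cmp (.branch x P Q) s (t + 1) s'
  | loop_done {x P s} : ¬ 0 < s.reg x → Runs lin cmp (.loop x P) s 1 s
  | loop_step {x P s t s' t' s''} : 0 < s.reg x → Runs lin cmp P s t s' →
      Runs lin cmp (.loop x P) s' t' s'' → Runs lin cmp (.loop x P) s (t + t' + 1) s''
  | compare (x y z s) : Runs lin cmp (.compare x y z) s 1
      (s.setReg x (if cmp (s.reg y) (s.reg z) then 1 else 0))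
  | linopt (X C s) : Runs lin cmp (.linopt X C) s (n + 1) (s.setVec X (lin (s.getVec n C)))

/-- The machine is deterministic: the number of steps and the result are determined. -/
theorem Runs.deterministic {n : ℕ} {lin : (Fin n → ℤ) → (Fin n → ℤ)} {cmp : ℤ → ℤ → Bool}
    {P : OracleProgram} {s s₁ s₂ : MachineState} {t₁ t₂ : ℕ}
    (h₁ : Runs lin cmp P s t₁ s₁) (h₂ : Runs lin cmp P s t₂ s₂) : t₁ = t₂ ∧ s₁ = s₂ := by
  induction h₁ generalizing t₂ s₂ with
  | seq _ _ ih ih' =>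
    cases h₂ with
    | seq h h' =>
      obtain ⟨rfl, rfl⟩ := ih h
      obtain ⟨rfl, rfl⟩ := ih' h'
      exact ⟨rfl, rfl⟩
  | branch_pos hx _ ih =>
    cases h₂ with
    | branch_pos _ h => obtain ⟨rfl, rfl⟩ := ih h; exact ⟨rfl, rfl⟩
    | branch_neg hx' _ => exact absurd hx hx'
  | branch_neg hx _ ih =>
    cases h₂ with
    | branch_pos hx' _ => exact absurd hx' hx
    | branch_neg _ h => obtain ⟨rfl, rfl⟩ := ih h; exact ⟨rfl, rfl⟩
  | loop_done hx =>
    cases h₂ with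
    | loop_done _ => exact ⟨rfl, rfl⟩
    | loop_step hx' _ _ => exact absurd hx' hx
  | loop_step hx _ _ ih ih' =>
    cases h₂ with
    | loop_done hx' => exact absurd hx hx'
    | loop_step _ h h' =>
      obtain ⟨rfl, rfl⟩ := ih h
      obtain ⟨rfl, rfl⟩ := ih' h'
      exact ⟨rfl, rfl⟩
  | _ => cases h₂; exact ⟨rfl, rfl⟩

/-- The program `P` provides, in at most `T n` steps, an `r`-best solution to
`min {f (wᵀ x) : x ∈ S}` (left in array `1`) for every `n`, every independence system
`S ⊆ {0,1}ⁿ` presented by a linear-optimization oracle, every weight vector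
`w ∈ {a₁, …, a_p}ⁿ`, and every `f : ℤ → ℝ` presented by a comparison oracle. -/
def ProvidesBestSolution {p : ℕ} (a : Fin p → ℕ) (r : ℕ) (P : OracleProgram) (T : ℕ → ℕ) : Prop :=
  ∀ (n : ℕ) (S : Set (Fin n → ℤ)) (lin : (Fin n → ℤ) → (Fin n → ℤ))
    (w : Fin n → ℤ) (f : ℤ → ℝ) (cmp : ℤ → ℤ → Bool),
    IsIndependenceSystem S → IsLinearOptimizationOracle S lin →
    (∀ j, ∃ i, w j = (a i : ℤ)) → IsComparisonOracle f cmp →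
    ∃ (t : ℕ) (s : MachineState), Runs lin cmp P (MachineState.init w) t s ∧
      t ≤ T n ∧ IsBestSolution r S w f (s.getVec n 1)

/-- `r` is an approximation constant for `a`: some algorithm, running in time polynomial in `n`,
provides an `r`-best solution to every instance with weights in `a`. -/
def IsApproximationConstant {p : ℕ} (a : Fin p → ℕ) (r : ℕ) : Prop :=
  ∃ (P : OracleProgram) (T : Polynomial ℕ), ProvidesBestSolution a r P (fun n => T.eval n)

/-! Let A be the largest weight. The pattern of a feasible x records, for each weight, how often x
uses it, with all counts of A or more identified; there are finitely many patterns, depending only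
on a. Let I be the set of saturated weights of a pattern, those used at least A times.

One oracle call yields a heaviest solution z of a given pattern: force a set T of at most pA ones by
a coefficient larger than the sum of all weights, give the other indices with weight in I their own
weight, and forbid the rest by a large negative coefficient (`forced_of_isMax`). Trying all T of
bounded size is polynomial. Deleting ones from z by a cutoff for each weight reaches every vector of
counts below that of z (`exists_dominating`).

If y has the same pattern as z, their weights differ by some d divisible by the gcd of the weights
in I. If d is a nonnegative combination of these weights, then an exchange argument
(`exists_le_of_sum_add_sum_eq`), which needs all counts on I to be at least A, represents d by ones
that z really has, so the weight of y is tried. Hence each missed weight is the maximum of its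
pattern minus a gap of the semigroup generated by I (`exists_missed_eq_sub`), and r(a) may be the
number of gaps summed over all patterns.

Bézout reduction bounds the gaps of I by A to the power |I|, and the sum over patterns factors into
the p-th power of A + A. Divisible tuples have no gaps. For p = 2 only the pattern with both weights
saturated has gaps, and their number is at most F(a). -/

/-! ### Reasoning about programs -/

/-- With the given oracles, `P` started in `s` halts after at most `T` steps in a memory
satisfying `Q`. -/
def Achieves {n : ℕ} (lin : (Fin n → ℤ) → (Fin n → ℤ)) (cmp : ℤ → ℤ → Bool) (P : OracleProgram)
    (s : MachineState) (T : ℕ) (Q : MachineState → Prop) : Prop :=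
  ∃ t s', Runs lin cmp P s t s' ∧ t ≤ T ∧ Q s'

namespace OracleProgram

/-- The program has neither loops nor calls of the linear-optimization oracle. -/
def IsStraight : OracleProgram → Prop
  | seq P Q => P.IsStraight ∧ Q.IsStraight
  | branch _ P Q => P.IsStraight ∧ Q.IsStraight
  | loop _ _ => False
  | linopt _ _ => False
  | _ => True

/-- A bound on the number of steps of a straight program. -/
def cost : OracleProgram → ℕ
  | seq P Q => P.cost + Q.cost
  | branch _ P Q => P.cost + Q.cost + 1
  | _ => 1

/-- The result of running a straight program. -/
def exec (cmp : ℤ → ℤ → Bool) : OracleProgram → MachineState → MachineState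
  | const x k, s => s.setReg x k
  | plus x y z, s => s.setReg x (s.reg y + s.reg z)
  | minus x y z, s => s.setReg x (s.reg y - s.reg z)
  | load x A y, s => s.setReg x (s.arr A (s.reg y))
  | store A y x, s => s.setEntry A (s.reg y) (s.reg x)
  | seq P Q, s => Q.exec cmp (P.exec cmp s)
  | branch x P Q, s => if 0 < s.reg x then P.exec cmp s else Q.exec cmp s
  | compare x y z, s => s.setReg x (if cmp (s.reg y) (s.reg z) then 1 else 0)
  | _, s => s

/-- Decrease register `x` by one and run `P`, as long as register `x` is positive. -/
def countdown (x : ℕ) (P : OracleProgram) : OracleProgram :=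
  loop x (seq (seq (const 5 1) (minus x x 5)) P)

end OracleProgram

section

variable {n : ℕ} {lin : (Fin n → ℤ) → (Fin n → ℤ)} {cmp : ℤ → ℤ → Bool}

open OracleProgram

theorem OracleProgram.IsStraight.exists_runs {P : OracleProgram} (h : P.IsStraight)
    (s : MachineState) : ∃ t, Runs lin cmp P s t (P.exec cmp s) ∧ t ≤ P.cost := by
  induction P generalizing s with
  | seq P Q ihP ihQ =>
    obtain ⟨t, h₁, ht⟩ := ihP h.1 s
    obtain ⟨t', h₂, ht'⟩ := ihQ h.2 (P.exec cmp s)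
    exact ⟨_, .seq h₁ h₂, Nat.add_le_add ht ht'⟩
  | branch x P Q ihP ihQ =>
    by_cases hx : 0 < s.reg x
    · obtain ⟨t, h₁, ht⟩ := ihP h.1 s
      exact ⟨t + 1, by simpa [exec, hx] using Runs.branch_pos hx h₁, by simp only [cost]; omega⟩
    · obtain ⟨t, h₁, ht⟩ := ihQ h.2 s
      exact ⟨t + 1, by simpa [exec, hx] using Runs.branch_neg hx h₁, by simp only [cost]; omega⟩
  | loop => exact h.elim
  | linopt => exact h.elim
  | skip => exact ⟨1, .skip s, le_rfl⟩
  | const x k => exact ⟨1, .const x k s, le_rfl⟩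
  | plus x y z => exact ⟨1, .plus x y z s, le_rfl⟩
  | minus x y z => exact ⟨1, .minus x y z s, le_rfl⟩
  | load x A y => exact ⟨1, .load x A y s, le_rfl⟩
  | store A y x => exact ⟨1, .store A y x s, le_rfl⟩
  | compare x y z => exact ⟨1, .compare x y z s, le_rfl⟩

namespace Achieves

theorem of_straight {P : OracleProgram} (h : P.IsStraight) {s : MachineState}
    {Q : MachineState → Prop} (hQ : Q (P.exec cmp s)) : Achieves lin cmp P s P.cost Q :=
  let ⟨t, hr, ht⟩ := h.exists_runs s
  ⟨t, _, hr, ht, hQ⟩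

theorem mono {P : OracleProgram} {s : MachineState} {T T' : ℕ} {Q Q' : MachineState → Prop}
    (h : Achieves lin cmp P s T Q) (hT : T ≤ T') (hQ : ∀ s', Q s' → Q' s') :
    Achieves lin cmp P s T' Q' :=
  let ⟨t, s', hr, ht, hq⟩ := h
  ⟨t, s', hr, ht.trans hT, hQ _ hq⟩

theorem seq {P P' : OracleProgram} {s : MachineState} {T T' : ℕ} {Q Q' : MachineState → Prop}
    (h : Achieves lin cmp P s T Q) (h' : ∀ s', Q s' → Achieves lin cmp P' s' T' Q') :
    Achieves lin cmp (.seq P P') s (T + T') Q' :=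
  let ⟨_, s', hr, ht, hq⟩ := h
  let ⟨_, s'', hr', ht', hq'⟩ := h' s' hq
  ⟨_, s'', .seq hr hr', Nat.add_le_add ht ht', hq'⟩

/-- The invariant is indexed by the rounds left. Besides the body, a round costs three steps:
loading 1 into register 5, the subtraction and the test. -/
theorem countdown {x : ℕ} {P : OracleProgram} {T : ℕ} (I : ℕ → MachineState → Prop)
    (hx : x ≠ 5)
    (hP : ∀ (k : ℕ) s, I (k + 1) s → Achieves lin cmp P ((s.setReg 5 1).setReg x k) T
      fun s' => I k s' ∧ s'.reg x = k)
    (k : ℕ) (s : MachineState) (hI : I k s) (hk : s.reg x = k) :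
    Achieves lin cmp (OracleProgram.countdown x P) s (k * (T + 3) + 1) (I 0) := by
  induction k generalizing s with
  | zero => exact ⟨1, s, .loop_done (by simp [hk]), by simp, hI⟩
  | succ k ih =>
    obtain ⟨t, s', hr, ht, hI', hk'⟩ := hP k s hI
    obtain ⟨t', s'', hr', ht', hI''⟩ := ih s' hI' hk'
    have e : Runs lin cmp (.seq (.const 5 1) (.minus x x 5)) s (1 + 1)
        ((s.setReg 5 1).setReg x k) := by
      have := Runs.seq (Runs.const (lin := lin) (cmp := cmp) 5 1 s)
        (Runs.minus x x 5 (s.setReg 5 1))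
      simpa [MachineState.setReg, hx, hk] using this
    refine ⟨_, s'', .loop_step (by rw [hk]; positivity) (.seq e hr) hr', ?_, hI''⟩
    rw [Nat.succ_mul]
    omega

end Achieves

end

/-- `s'` differs from `s` only in the registers `R` and the arrays `B`. -/
def Keeps (R B : Finset ℕ) (s s' : MachineState) : Prop :=
  (∀ r, r ∉ R → s'.reg r = s.reg r) ∧ ∀ A, A ∉ B → s'.arr A = s.arr A

theorem Keeps.refl (R B : Finset ℕ) (s : MachineState) : Keeps R B s s :=
  ⟨fun _ _ => rfl, fun _ _ => rfl⟩

theorem Keeps.trans {R R' B B' : Finset ℕ} {s s' s'' : MachineState} (h : Keeps R B s s')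
    (h' : Keeps R' B' s' s'') : Keeps (R ∪ R') (B ∪ B') s s'' := by
  refine ⟨fun r hr => ?_, fun A hA => ?_⟩
  · rw [Finset.mem_union, not_or] at hr
    rw [h'.1 r hr.2, h.1 r hr.1]
  · rw [Finset.mem_union, not_or] at hA
    rw [h'.2 A hA.2, h.2 A hA.1]

/-! ### The program -/

/-- A memory cell: an array and an index. -/
abbrev Cell : Type := ℕ × ℤ

namespace OracleProgram

/-- Run `P` for all contents of the given cells with numbers from `0` to the contents of
register `0`. -/
def forCells (P : OracleProgram) : List Cell → OracleProgram
  | [] => P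
  -- The counter register depends on the length of the remaining list, so nested loops never share
  -- one. It starts at n + 1 and is decreased before the body runs, so the contents n, …, 0 are
  -- tried.
  | c :: l => seq (seq (const 5 1) (plus (10 + l.length) 0 5))
      (countdown (10 + l.length)
        (seq (seq (const 5 c.2) (store c.1 5 (10 + l.length))) (forCells P l)))

/-- Run `P` for `j = n - 1, …, 0`, with `j` in register `4`. -/
def forIndices (P : OracleProgram) : OracleProgram :=
  seq (seq (const 5 0) (plus 4 0 5)) (countdown 4 P)

/-- Add the weights and one in register `3`. -/
def computeBig : OracleProgram :=
  seq (const 3 1) (forIndices (seq (load 6 0 4) (plus 3 3 6)))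

/-- Put the weight of an index below the bound in array `3` for this weight, and the negative of
register `3` for the other indices, into array `2`. -/
def restrictTypes : OracleProgram :=
  forIndices (seq (load 6 0 4) (seq (load 7 3 6) (seq (minus 7 7 4)
    (branch 7 (store 2 4 6) (seq (const 5 0) (seq (minus 5 5 3) (store 2 4 5)))))))

/-- Put register `3` into array `2` at the first `K` indices listed in array `4`. -/
def forceIndices : ℕ → OracleProgram
  | 0 => skip
  | K + 1 => seq (forceIndices K)
      (seq (const 5 (K : ℤ)) (seq (load 5 4 5) (store 2 5 3)))

/-- Delete from the vector in array `6` the indices not below the bound in array `5` for their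
weight, and put the total weight of the rest in register `9`. -/
def truncate : OracleProgram :=
  seq (const 9 0) (forIndices (seq (load 6 0 4) (seq (load 7 5 6) (seq (minus 7 7 4)
    (branch 7 (seq (load 8 6 4) (branch 8 (plus 9 9 6) skip))
      (seq (const 8 0) (store 6 4 8)))))))

/-- Replace the best solution so far by the one in array `6` if this is better. -/
def keepBetter : OracleProgram :=
  seq (compare 5 2 9) (branch 5 skip
    (seq (forIndices (seq (load 5 6 4) (store 1 4 5))) (seq (const 5 0) (plus 2 9 5))))

/-- One call of the oracle and the comparison of its result with the best solution so far. -/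
def tryCandidate (K : ℕ) : OracleProgram :=
  seq restrictTypes (seq (forceIndices K) (seq (linopt 6 2) (seq truncate keepBetter)))

end OracleProgram

/-! ### Effects and step counts of the subroutines -/

section

variable {n : ℕ} {lin : (Fin n → ℤ) → (Fin n → ℤ)} {cmp : ℤ → ℤ → Bool}

open OracleProgram MachineState

theorem Achieves.forIndices {P : OracleProgram} {T : ℕ} (I : ℕ → MachineState → Prop)
    (hP : ∀ (k : ℕ) s, k < n → I (k + 1) s → Achieves lin cmp P ((s.setReg 5 1).setReg 4 k) T
      fun s' => I k s' ∧ s'.reg 4 = k)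
    (s : MachineState) (hn : s.reg 0 = n) (hI : I n ((s.setReg 5 0).setReg 4 n)) :
    Achieves lin cmp (forIndices P) s (n * (T + 3) + 3) (I 0) := by
  have h := Achieves.countdown (lin := lin) (cmp := cmp) (x := 4) (P := P) (T := T)
    (fun k s => k ≤ n ∧ I k s) (by norm_num)
    (fun k s h => (hP k s h.1 h.2).mono le_rfl fun s' h' => ⟨⟨by omega, h'.1⟩, h'.2⟩)
    n _ ⟨le_rfl, hI⟩ (by simp [setReg])
  refine Achieves.mono (Achieves.seq (Achieves.of_straight
    (Q := fun s' => s' = (s.setReg 5 0).setReg 4 n) (by simp [IsStraight]) ?_) fun s' hs' => hs' ▸ h)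
    ?_ fun s' h => h.2
  · simp [exec, setReg, hn]
  · simp only [cost]; omega

theorem achieves_computeBig (s : MachineState) (hn : s.reg 0 = n) :
    Achieves lin cmp computeBig s (n * 5 + 4) fun s' => Keeps {3, 4, 5, 6} ∅ s s' ∧
      s'.reg 3 = 1 + ∑ j ∈ Finset.range n, s.arr 0 j := by
  refine Achieves.mono (Achieves.seq (Achieves.of_straight (Q := fun s' => s' = s.setReg 3 1)
    (by simp [IsStraight]) rfl) fun s' hs' => Achieves.forIndices (T := 2)
      (fun k s' => Keeps {3, 4, 5, 6} ∅ s s' ∧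
        s'.reg 3 = 1 + ∑ j ∈ Finset.Ico k n, s.arr 0 j) ?_ s' ?_ ?_) ?_ ?_
  · rintro k s' hk ⟨h, h3⟩
    refine Achieves.of_straight (by simp [IsStraight]) ⟨⟨⟨fun r hr => ?_, fun A hA => ?_⟩, ?_⟩, ?_⟩
    · have := h.1 r hr
      simp only [Finset.mem_insert, Finset.mem_singleton, not_or] at hr
      simp [exec, setReg, hr, this]
    · simpa [exec, setReg] using h.2 A hA
    · simp [exec, setReg, h3, h.2, Finset.sum_eq_sum_Ico_succ_bot hk, add_left_comm, add_comm]
    · simp [exec, setReg]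
  · simp [hs', setReg, hn]
  · subst hs'
    refine ⟨⟨fun r hr => ?_, fun A hA => ?_⟩, ?_⟩
    · simp only [Finset.mem_insert, Finset.mem_singleton, not_or] at hr
      simp [setReg, hr]
    · simp [setReg]
    · simp [setReg]
  · simp only [cost]; omega
  · intro s' h
    simpa using h

/-- The entries of array `2` after `restrictTypes`. -/
theorem achieves_restrictTypes (s : MachineState) (hn : s.reg 0 = n) :
    Achieves lin cmp restrictTypes s (n * 11 + 3) fun s' => Keeps {4, 5, 6, 7} {2} s s' ∧
      ∀ j : ℕ, j < n → s'.arr 2 j =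
        if (j : ℤ) < s.arr 3 (s.arr 0 j) then s.arr 0 j else - s.reg 3 := by
  refine Achieves.mono (Achieves.forIndices (T := 8)
      (fun k s' => Keeps {4, 5, 6, 7} {2} s s' ∧ ∀ j : ℕ, k ≤ j → j < n → s'.arr 2 j =
        if (j : ℤ) < s.arr 3 (s.arr 0 j) then s.arr 0 j else - s.reg 3) ?_ s hn ?_) le_rfl ?_
  · rintro k s' hk ⟨h, h2⟩
    refine Achieves.mono (Achieves.of_straight (by simp [IsStraight])
      (Q := fun s' => (Keeps {4, 5, 6, 7} {2} s s' ∧ ∀ j : ℕ, k ≤ j → j < n → s'.arr 2 j =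
        if (j : ℤ) < s.arr 3 (s.arr 0 j) then s.arr 0 j else - s.reg 3) ∧ s'.reg 4 = k)
      ⟨⟨⟨fun r hr => ?_, fun A hA => ?_⟩, fun j hj hjn => ?_⟩, ?_⟩) (by simp [cost])
      fun _ h => h
    · have := h.1 r hr
      simp only [Finset.mem_insert, Finset.mem_singleton, not_or] at hr
      simp [exec, setReg, setEntry, apply_ite reg, ite_apply, hr, this]
    · have := h.2 A hA
      simp only [Finset.mem_singleton] at hA
      simp [exec, setReg, setEntry, apply_ite arr, ite_apply, this, hA]
    · rcases hj.eq_or_lt with rfl | hj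
      · by_cases hc : (k : ℤ) < s.arr 3 (s.arr 0 k) <;>
          simp [exec, setReg, setEntry, h.2, h.1, hc]
      · have h2' := h2 j hj hjn
        have hne : (j : ℤ) ≠ k := by omega
        simp [exec, setReg, setEntry, apply_ite arr, ite_apply, hne, h2']
    · simp [exec, setReg, setEntry, apply_ite reg, ite_apply]
  · refine ⟨⟨fun r hr => ?_, fun A hA => rfl⟩, fun j hj hjn => by omega⟩
    simp only [Finset.mem_insert, Finset.mem_singleton, not_or] at hr
    simp [setReg, hr]
  · rintro s' ⟨h, h2⟩
    exact ⟨h, fun j => h2 j j.zero_le⟩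

theorem achieves_forceIndices (K : ℕ) (s : MachineState) :
    Achieves lin cmp (forceIndices K) s (K * 3 + 1) fun s' => Keeps {5} {2} s s' ∧
      ∀ i, s'.arr 2 i = if ∃ k < K, s.arr 4 (k : ℤ) = i then s.reg 3 else s.arr 2 i := by
  induction K with
  | zero => exact ⟨1, s, .skip s, by simp, .refl _ _ s, by simp⟩
  | succ K ih =>
    refine Achieves.mono (Achieves.seq ih fun s' hs' =>
      Achieves.of_straight (by simp [IsStraight])
      (Q := fun s' => Keeps {5} {2} s s' ∧
      ∀ i, s'.arr 2 i = if ∃ k < K + 1, s.arr 4 (k : ℤ) = i then s.reg 3 else s.arr 2 i)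
      ⟨⟨fun r hr => ?_, fun A hA => ?_⟩, fun i => ?_⟩) (by simp [cost]; omega) fun _ h => h
    · have := hs'.1.1 r hr
      simp only [Finset.mem_singleton] at hr
      simp [exec, setReg, setEntry, hr, this]
    · have := hs'.1.2 A hA
      simp only [Finset.mem_singleton] at hA
      simp [exec, setReg, setEntry, hA, this]
    · by_cases hi : s.arr 4 (K : ℤ) = i
      · have : ∃ k < K + 1, s.arr 4 (k : ℤ) = i := ⟨K, by omega, hi⟩
        rw [if_pos this]
        simp [exec, setReg, setEntry, hs'.1.1, hs'.1.2, hi]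
      · have : (∃ k < K + 1, s.arr 4 (k : ℤ) = i) ↔ ∃ k < K, s.arr 4 (k : ℤ) = i := by
          refine ⟨fun ⟨k, hk, h⟩ => ⟨k, ?_, h⟩, fun ⟨k, hk, h⟩ => ⟨k, by omega, h⟩⟩
          rcases (Nat.lt_succ_iff_lt_or_eq.1 hk) with h' | rfl
          · exact h'
          · exact absurd h hi
        simp only [this]
        simp [exec, setReg, setEntry, hs'.1.2, Ne.symm hi, hs'.2]

theorem achieves_truncate (s : MachineState) (hn : s.reg 0 = n) :
    Achieves lin cmp truncate s (n * 13 + 4) fun s' => Keeps {4, 5, 6, 7, 8, 9} {6} s s' ∧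
      (∀ j : ℕ, j < n → s'.arr 6 j =
        if (j : ℤ) < s.arr 5 (s.arr 0 j) then s.arr 6 j else 0) ∧
      s'.reg 9 = ∑ j ∈ Finset.range n,
        if (j : ℤ) < s.arr 5 (s.arr 0 j) ∧ 0 < s.arr 6 j then s.arr 0 j else 0 := by
  set I : ℕ → MachineState → Prop := fun k s' => Keeps {4, 5, 6, 7, 8, 9} {6} s s' ∧
      (∀ j : ℕ, k ≤ j → j < n → s'.arr 6 j =
        if (j : ℤ) < s.arr 5 (s.arr 0 j) then s.arr 6 j else 0) ∧
      (∀ j : ℕ, j < k → s'.arr 6 j = s.arr 6 j) ∧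
      s'.reg 9 = ∑ j ∈ Finset.Ico k n,
        if (j : ℤ) < s.arr 5 (s.arr 0 j) ∧ 0 < s.arr 6 j then s.arr 0 j else 0 with hI
  refine Achieves.mono (Achieves.seq (Achieves.of_straight (Q := fun s' => s' = s.setReg 9 0)
    (by simp [IsStraight]) rfl) fun s' hs' => Achieves.forIndices (T := 10) I ?_ s' ?_ ?_) ?_ ?_
  · rintro k s' hk ⟨h, h6, h6', h9⟩
    refine Achieves.mono (Achieves.of_straight (by simp [IsStraight])
      (Q := fun s' => I k s' ∧ s'.reg 4 = k)
      ⟨⟨⟨fun r hr => ?_, fun A hA => ?_⟩, fun j hj hjn => ?_, fun j hj => ?_, ?_⟩, ?_⟩)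
      (by simp [cost]) fun _ h => h
    · have := h.1 r hr
      simp only [Finset.mem_insert, Finset.mem_singleton, not_or] at hr
      simp [exec, setReg, setEntry, apply_ite reg, ite_apply, hr, this]
    · have := h.2 A hA
      simp only [Finset.mem_singleton] at hA
      simp [exec, setReg, setEntry, apply_ite arr, ite_apply, this, hA]
    · rcases hj.eq_or_lt with rfl | hj
      · by_cases hc : (k : ℤ) < s.arr 5 (s.arr 0 k) <;> by_cases hd : 0 < s.arr 6 k <;>
          simp [exec, setReg, setEntry, h.2, h6', hc, hd]
      · have h2' := h6 j hj hjn
        have hne : (j : ℤ) ≠ k := by omega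
        simp [exec, setReg, setEntry, apply_ite arr, ite_apply, hne, h2']
    · have h2' := h6' j (by omega)
      have hne : (j : ℤ) ≠ k := by omega
      simp [exec, setReg, setEntry, apply_ite arr, ite_apply, hne, h2']
    · rw [Finset.sum_eq_sum_Ico_succ_bot hk]
      by_cases hc : (k : ℤ) < s.arr 5 (s.arr 0 k) <;> by_cases hd : 0 < s.arr 6 k <;>
        simp [exec, setReg, setEntry, h.2, h6', hc, hd, h9, add_comm]
    · simp [exec, setReg, setEntry, apply_ite reg, ite_apply]
  · simp [hs', setReg, hn]
  · subst hs'
    refine ⟨⟨fun r hr => ?_, fun A hA => rfl⟩, fun j hj hjn => by omega, fun j hj => rfl, ?_⟩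
    · simp only [Finset.mem_insert, Finset.mem_singleton, not_or] at hr
      simp [setReg, hr]
    · simp [setReg]
  · simp only [cost]; omega
  · rintro s' ⟨h, h6, -, h9⟩
    exact ⟨h, fun j => h6 j j.zero_le, by simpa using h9⟩

theorem achieves_keepBetter (s : MachineState) (hn : s.reg 0 = n) :
    Achieves lin cmp keepBetter s (n * 5 + 7) fun s' => Keeps {2, 4, 5} {1} s s' ∧
      if cmp (s.reg 2) (s.reg 9) then s'.reg 2 = s.reg 2 ∧ s'.arr 1 = s.arr 1
      else s'.reg 2 = s.reg 9 ∧ ∀ j : ℕ, j < n → s'.arr 1 j = s.arr 6 j := by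
  by_cases hc : cmp (s.reg 2) (s.reg 9) = true
  · refine ⟨_, _, .seq (.compare ..) (.branch_pos ?_ (.skip _)), by omega, ⟨?_, ?_⟩, ?_⟩
    · simp [setReg, hc]
    · intro r hr
      simp only [Finset.mem_insert, Finset.mem_singleton, not_or] at hr
      simp [setReg, hr]
    · simp [setReg]
    · simp [setReg, hc]
  · have key : Achieves lin cmp (.seq (.forIndices (.seq (.load 5 6 4) (.store 1 4 5)))
        (.seq (.const 5 0) (.plus 2 9 5))) (s.setReg 5 0) (n * 5 + 5) fun s' =>
        Keeps {2, 4, 5} {1} s s' ∧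
          s'.reg 2 = s.reg 9 ∧ ∀ j : ℕ, j < n → s'.arr 1 j = s.arr 6 j := by
      refine Achieves.mono (Achieves.seq (Achieves.forIndices (T := 2)
        (fun k s' => Keeps {4, 5} {1} s s' ∧ ∀ j : ℕ, k ≤ j → j < n → s'.arr 1 j = s.arr 6 j)
        ?_ _ ?_ ?_) fun s' hs' => Achieves.of_straight (by simp [IsStraight])
          (Q := fun s' => Keeps {2, 4, 5} {1} s s' ∧
          s'.reg 2 = s.reg 9 ∧ ∀ j : ℕ, j < n → s'.arr 1 j = s.arr 6 j)
          ⟨⟨fun r hr => ?_, fun A hA => ?_⟩, ?_, ?_⟩) (by simp [cost]) fun _ h => h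
      · rintro k s' hk ⟨h, h1⟩
        refine Achieves.of_straight (by simp [IsStraight])
          ⟨⟨⟨fun r hr => ?_, fun A hA => ?_⟩, fun j hj hjn => ?_⟩, ?_⟩
        · have := h.1 r hr
          simp only [Finset.mem_insert, Finset.mem_singleton, not_or] at hr
          simp [exec, setReg, setEntry, hr, this]
        · have := h.2 A hA
          simp only [Finset.mem_singleton] at hA
          simp [exec, setReg, setEntry, hA, this]
        · rcases hj.eq_or_lt with rfl | hj
          · simp [exec, setReg, setEntry, h.2]
          · have hne : (j : ℤ) ≠ k := by omega
            simp [exec, setReg, setEntry, hne, h1 j hj hjn]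
        · simp [exec, setReg, setEntry]
      · simp [setReg, hn]
      · refine ⟨⟨fun r hr => ?_, fun A hA => rfl⟩, fun j hj hjn => by omega⟩
        simp only [Finset.mem_insert, Finset.mem_singleton, not_or] at hr
        simp [setReg, hr]
      · have := hs'.1.1 r
        simp only [Finset.mem_insert, Finset.mem_singleton, not_or] at hr this
        simp [exec, setReg, hr, this]
      · simpa [exec, setReg] using hs'.1.2 A hA
      · simp [exec, setReg, hs'.1.1]
      · intro j hj
        simp [exec, setReg, hs'.2 j j.zero_le hj]
    obtain ⟨t, s', hr, ht, hk, hq⟩ := key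
    have hs : s.setReg 5 (if cmp (s.reg 2) (s.reg 9) = true then 1 else 0) = s.setReg 5 0 := by
      rw [if_neg hc]
    have hr' := Runs.compare (lin := lin) (cmp := cmp) 5 2 9 s
    rw [hs] at hr'
    refine ⟨_, s', .seq hr' (.branch_neg ?_ hr), by omega, hk, ?_⟩
    · simp [setReg]
    · rwa [if_neg hc]

end

/-! ### What the program does -/

section

variable {n : ℕ} {lin : (Fin n → ℤ) → (Fin n → ℤ)} {cmp : ℤ → ℤ → Bool}

open OracleProgram MachineState

/-- The vector about which the linear-optimization oracle is asked if the arrays are `D`. -/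
def queryVec (w : Fin n → ℤ) (K : ℕ) (D : ℕ → ℤ → ℤ) : Fin n → ℤ := fun j =>
  if ∃ k < K, D 4 (k : ℤ) = (j : ℕ) then 1 + ∑ i, w i
  else if ((j : ℕ) : ℤ) < D 3 (w j) then w j else -(1 + ∑ i, w i)

/-- The vector `x` with the entries not below the bounds in `D` deleted. -/
def truncVec (w : Fin n → ℤ) (D : ℕ → ℤ → ℤ) (x : Fin n → ℤ) : Fin n → ℤ := fun j =>
  if ((j : ℕ) : ℤ) < D 5 (w j) then x j else 0

/-- The solution that is considered if the arrays are `D`. -/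
def candidate (lin : (Fin n → ℤ) → (Fin n → ℤ)) (w : Fin n → ℤ) (K : ℕ) (D : ℕ → ℤ → ℤ) :
    Fin n → ℤ :=
  truncVec w D (lin (queryVec w K D))

theorem candidate_congr (w : Fin n → ℤ) (K : ℕ) {D D' : ℕ → ℤ → ℤ}
    (h : ∀ A ∈ ({3, 4, 5} : Finset ℕ), D A = D' A) :
    candidate lin w K D = candidate lin w K D' := by
  unfold candidate truncVec queryVec
  rw [h 3 (by simp), h 4 (by simp), h 5 (by simp)]

/-- Truncation only turns ones into zeros, so downward closure applies. -/
theorem truncVec_mem {S : Set (Fin n → ℤ)} (hS : IsIndependenceSystem S) (w : Fin n → ℤ)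
    (D : ℕ → ℤ → ℤ) {x : Fin n → ℤ} (hx : x ∈ S) : truncVec w D x ∈ S := by
  refine hS.down_closed _ x (fun j => ?_) (fun j => ?_) hx
  · have := hS.zeroOne x hx j
    unfold truncVec
    split_ifs <;> simp [this]
  · have := hS.zeroOne x hx j
    unfold truncVec
    dsimp only
    split_ifs <;> rcases this with h | h <;> simp [h]

/-- The memory holds the instance and, as the best solution so far, a feasible one. -/
structure HoldsSolution (S : Set (Fin n → ℤ)) (w : Fin n → ℤ) (s : MachineState) : Prop where
  size : s.reg 0 = n
  big : s.reg 3 = 1 + ∑ i, w i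
  weights : s.getVec n 0 = w
  mem : s.getVec n 1 ∈ S
  value : s.reg 2 = totalWeight w (s.getVec n 1)

theorem HoldsSolution.congr {S : Set (Fin n → ℤ)} {w : Fin n → ℤ} {s s' : MachineState}
    (h : HoldsSolution S w s) (h0 : s'.reg 0 = s.reg 0) (h2 : s'.reg 2 = s.reg 2)
    (h3 : s'.reg 3 = s.reg 3) (hw : s'.arr 0 = s.arr 0)
    (hb : s'.getVec n 1 = s.getVec n 1) : HoldsSolution S w s' :=
  ⟨h0.trans h.size, h3.trans h.big, by rw [← h.weights]; funext j; simp [getVec, hw], hb ▸ h.mem,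
    h2.trans (hb ▸ h.value)⟩

/-- The `Keeps` clause matters to the enclosing loops: their counters and the enumerated arrays 3, 4
and 5 survive the call. -/
theorem achieves_tryCandidate {S : Set (Fin n → ℤ)} (hS : IsIndependenceSystem S)
    (hlin : IsLinearOptimizationOracle S lin) {f : ℤ → ℝ} (hcmp : IsComparisonOracle f cmp)
    {w : Fin n → ℤ} (K : ℕ) (s : MachineState) (hs : HoldsSolution S w s) :
    Achieves lin cmp (tryCandidate K) s (n * 30 + (K * 3 + 16)) fun s' =>
      HoldsSolution S w s' ∧ f (s'.reg 2) ≤ f (s.reg 2) ∧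
      f (s'.reg 2) ≤ f (totalWeight w (candidate lin w K s.arr)) ∧
      Keeps {2, 4, 5, 6, 7, 8, 9} {1, 2, 6} s s' := by
  have hw : ∀ j : Fin n, s.arr 0 ((j : ℕ) : ℤ) = w j := fun j => congrFun hs.weights j
  refine Achieves.mono
    (Achieves.seq (achieves_restrictTypes s hs.size) fun s₁ h₁ =>
    Achieves.seq (achieves_forceIndices K s₁) fun s₂ h₂ =>
    Achieves.seq (Q := fun s₃ => s₃ = s₂.setVec 6 (lin (s₂.getVec n 2)))
      ⟨_, _, .linopt 6 2 s₂, le_rfl, rfl⟩ fun s₃ h₃ =>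
    Achieves.seq (achieves_truncate s₃ ?_) fun s₄ h₄ =>
    Achieves.mono (achieves_keepBetter s₄ ?_) le_rfl fun s₅ h₅ => ?_)
    (by omega) fun s' h' => h'
  · simp [h₃, setVec, h₂.1.1, h₁.1.1, hs.size]
  · simp [h₄.1.1, h₃, setVec, h₂.1.1, h₁.1.1, hs.size]
  obtain ⟨k₁, h₁⟩ := h₁
  obtain ⟨k₂, h₂⟩ := h₂
  obtain ⟨k₄, h₄, h₄'⟩ := h₄
  obtain ⟨k₅, h₅⟩ := h₅
  have hq : s₂.getVec n 2 = queryVec w K s.arr := by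
    funext j
    have e1 := h₁ j j.2
    simp only [getVec, queryVec, h₂, e1, hw, k₁.2 4 (by simp), k₁.1 3 (by simp), hs.big]
  have k₃ : Keeps ∅ {6} s₂ s₃ := by
    refine ⟨fun r _ => by simp [h₃, setVec], fun A hA => ?_⟩
    simp only [Finset.mem_singleton] at hA
    simp [h₃, setVec, hA]
  have K₃ := (k₁.trans k₂).trans k₃
  have e6 : ∀ j : Fin n, s₃.arr 6 ((j : ℕ) : ℤ) = lin (queryVec w K s.arr) j := by
    intro j
    simp [h₃, setVec, hq]
  have a0 : s₃.arr 0 = s.arr 0 := K₃.2 0 (by decide)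
  have a5 : s₃.arr 5 = s.arr 5 := K₃.2 5 (by decide)
  have hx : s₄.getVec n 6 = candidate lin w K s.arr := by
    funext j
    simp only [getVec, candidate, truncVec, h₄ j j.2, a0, a5, hw, e6]
  have hmem : candidate lin w K s.arr ∈ S := truncVec_mem hS w _ (hlin _).1
  have h9 : s₄.reg 9 = totalWeight w (candidate lin w K s.arr) := by
    rw [h₄', Finset.sum_range, totalWeight]
    refine Finset.sum_congr rfl fun j _ => ?_
    rw [a0, a5, hw, e6]
    simp only [candidate, truncVec]
    rcases hS.zeroOne _ (hlin (queryVec w K s.arr)).1 j with h | h <;>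
      split_ifs <;> simp_all
  have K₄ := K₃.trans k₄
  have K₅ := K₄.trans k₅
  have e2 : s₄.reg 2 = s.reg 2 := K₄.1 2 (by decide)
  have hK : Keeps {2, 4, 5, 6, 7, 8, 9} {1, 2, 6} s s₅ := by
    have hR : {4, 5, 6, 7} ∪ {5} ∪ ∅ ∪ {4, 5, 6, 7, 8, 9} ∪ {2, 4, 5} ⊆
      ({2, 4, 5, 6, 7, 8, 9} : Finset ℕ) := by decide
    have hB : {2} ∪ {2} ∪ {6} ∪ {6} ∪ {1} ⊆ ({1, 2, 6} : Finset ℕ) := by decide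
    exact ⟨fun r hr => K₅.1 r fun h => hr (hR h), fun A hA => K₅.2 A fun h => hA (hB h)⟩
  have e0 : s₅.getVec n 0 = w := by
    rw [← hs.weights]
    funext j
    simp [getVec, hK.2 0 (by decide)]
  have c := hcmp (s₄.reg 2) (s₄.reg 9)
  rw [e2, h9] at c
  rw [e2, h9] at h₅
  by_cases hc : cmp (s.reg 2) (totalWeight w (candidate lin w K s.arr)) = true
  · rw [if_pos hc] at h₅
    have hb : s₅.getVec n 1 = s.getVec n 1 := by
      funext j
      simp [getVec, h₅.2, K₄.2 1 (by decide)]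
    refine ⟨hs.congr (hK.1 0 (by decide)) h₅.1 (hK.1 3 (by decide)) (hK.2 0 (by decide)) hb,
      by rw [h₅.1], by rw [h₅.1]; exact c.1 hc, hK⟩
  · rw [if_neg hc] at h₅
    have hb : s₅.getVec n 1 = candidate lin w K s.arr := by
      rw [← hx]
      funext j
      exact h₅.2 j j.2
    refine ⟨⟨(hK.1 0 (by decide)).trans hs.size, (hK.1 3 (by decide)).trans hs.big, e0,
      hb ▸ hmem, by rw [hb, h₅.1]⟩, ?_, by rw [h₅.1], hK⟩
    rw [h₅.1]
    exact (not_le.1 fun h => hc (c.2 h)).le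

/-! ### Exhaustive search over cell contents -/

/-- A bound on the number of steps of `forCells` for `m` cells. -/
def forCellsTime (n T : ℕ) : ℕ → ℕ
  | 0 => T
  | m + 1 => (n + 1) * (forCellsTime n T m + 5) + 3

/-- Induction on the list of cells. Since the best value never gets worse, a comparison won in one
round stays won in all later ones. -/
theorem achieves_forCells {S : Set (Fin n → ℤ)} {f : ℤ → ℝ} {w : Fin n → ℤ} {P : OracleProgram}
    {T K : ℕ}
    (hP : ∀ s, HoldsSolution S w s → Achieves lin cmp P s T fun s' =>
      HoldsSolution S w s' ∧ f (s'.reg 2) ≤ f (s.reg 2) ∧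
      f (s'.reg 2) ≤ f (totalWeight w (candidate lin w K s.arr)) ∧
      Keeps {2, 4, 5, 6, 7, 8, 9} {1, 2, 6} s s')
    (l : List Cell) (hl : ∀ c ∈ l, c.1 ∈ ({3, 4, 5} : Finset ℕ)) (s : MachineState)
    (hs : HoldsSolution S w s) :
    Achieves lin cmp (forCells P l) s (forCellsTime n T l.length) fun s' =>
      HoldsSolution S w s' ∧ f (s'.reg 2) ≤ f (s.reg 2) ∧
      (∀ r, 10 + l.length ≤ r → s'.reg r = s.reg r) ∧
      (∀ A ∈ ({3, 4, 5} : Finset ℕ), ∀ i, (A, i) ∉ l → s'.arr A i = s.arr A i) ∧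
      ∀ D : ℕ → ℤ → ℤ,
        (∀ A ∈ ({3, 4, 5} : Finset ℕ), ∀ i, (A, i) ∉ l → D A i = s.arr A i) →
        (∀ c ∈ l, 0 ≤ D c.1 c.2 ∧ D c.1 c.2 ≤ n) →
        f (s'.reg 2) ≤ f (totalWeight w (candidate lin w K D)) := by
  induction l generalizing s with
  | nil =>
    refine (hP s hs).mono le_rfl fun s' h => ⟨h.1, h.2.1, fun r hr => h.2.2.2.1 r ?_,
      fun A hA i _ => ?_, fun D hD _ => ?_⟩
    · simp only [Finset.mem_insert, Finset.mem_singleton, List.length_nil] at hr ⊢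
      omega
    · rw [h.2.2.2.2 A]
      simp only [Finset.mem_insert, Finset.mem_singleton] at hA ⊢
      omega
    · rw [candidate_congr w K (D' := s.arr) fun A hA => funext fun i => hD A hA i (by simp)]
      exact h.2.2.1
  | cons c l ih =>
    have hc := hl c (by simp)
    have hl' : ∀ c ∈ l, c.1 ∈ ({3, 4, 5} : Finset ℕ) := fun d hd => hl d (by simp [hd])
    have hne : c.1 ≠ 0 ∧ c.1 ≠ 1 := by
      simp only [Finset.mem_insert, Finset.mem_singleton] at hc
      omega
    -- With k rounds left, all assignments with content at least k in the cell c have been dealt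
    -- with.
    set I : ℕ → MachineState → Prop := fun k s' =>
      HoldsSolution S w s' ∧ f (s'.reg 2) ≤ f (s.reg 2) ∧
      (∀ r, 10 + (c :: l).length ≤ r → s'.reg r = s.reg r) ∧
      (∀ A ∈ ({3, 4, 5} : Finset ℕ), ∀ i, (A, i) ∉ c :: l → s'.arr A i = s.arr A i) ∧
      ∀ D : ℕ → ℤ → ℤ,
        (∀ A ∈ ({3, 4, 5} : Finset ℕ), ∀ i, (A, i) ∉ c :: l → D A i = s.arr A i) →
        (∀ d ∈ c :: l, 0 ≤ D d.1 d.2 ∧ D d.1 d.2 ≤ n) → k ≤ D c.1 c.2 →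
        f (s'.reg 2) ≤ f (totalWeight w (candidate lin w K D)) with hI
    refine Achieves.mono (Achieves.seq (Achieves.of_straight (by simp [IsStraight])
      (Q := fun s' => s' = (s.setReg 5 1).setReg (10 + l.length) ((n + 1 : ℕ) : ℤ)) ?_) fun s₁ h₁ =>
      Achieves.countdown (T := 2 + forCellsTime n T l.length) I (by omega) ?_ (n + 1) s₁ ?_ ?_)
      ?_ fun s' h => ?_
    · simp [exec, setReg, hs.size]
    · rintro k s' ⟨i1, i2, i3, i4, i5⟩
      set s₂ := (((s'.setReg 5 1).setReg (10 + l.length) k).setReg 5 c.2).setEntry c.1 c.2 k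
        with hs₂
      have r₂ : ∀ r, r ≠ 5 → r ≠ 10 + l.length → s₂.reg r = s'.reg r := by
        intro r h5 h10
        simp [hs₂, setReg, setEntry, h5, h10]
      have x₂ : s₂.reg (10 + l.length) = k := by
        simp [hs₂, setReg, setEntry, show 10 + l.length ≠ 5 by omega]
      have a₂ : ∀ A i, (A, i) ≠ c → s₂.arr A i = s'.arr A i := by
        rintro A i hAi
        by_cases hA : A = c.1
        · have hi : i ≠ c.2 := fun hi => hAi (Prod.ext hA hi)
          simp [hs₂, setReg, setEntry, hA, hi]
        · simp [hs₂, setReg, setEntry, hA]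
      have c₂ : s₂.arr c.1 c.2 = k := by simp [hs₂, setReg, setEntry]
      have H₂ : HoldsSolution S w s₂ := by
        refine i1.congr (r₂ _ (by omega) (by omega)) (r₂ _ (by omega) (by omega))
          (r₂ _ (by omega) (by omega)) ?_ ?_
        · simp [hs₂, setReg, setEntry, hne.1.symm]
        · funext j
          simp [hs₂, setReg, setEntry, hne.2.symm, getVec]
      refine Achieves.seq (Achieves.of_straight (by simp [IsStraight]) (Q := fun s' => s' = s₂) ?_)
        fun s₃ h₃ => h₃ ▸ Achieves.mono (ih hl' s₂ H₂) le_rfl ?_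
      · simp [exec, hs₂, setReg, show 10 + l.length ≠ 5 by omega]
      · rintro s₄ ⟨j1, j2, j3, j4, j5⟩
        have e2 : s₂.reg 2 = s'.reg 2 := r₂ _ (by omega) (by omega)
        rw [e2] at j2
        refine ⟨⟨j1, j2.trans i2, fun r hr => ?_, fun A hA i hi => ?_, fun D hD hD' hk => ?_⟩, ?_⟩
        · simp only [List.length_cons] at hr
          rw [j3 r (by omega), r₂ r (by omega) (by omega), i3 r (by simp only [List.length_cons]; omega)]
        · rw [j4 A hA i (fun h => hi (by simp [h])), a₂ A i (fun h => hi (by simp [h])), i4 A hA i hi]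
        -- Content exactly k is covered by the inner loops of this round, larger content by earlier
        -- rounds.
        · rcases hk.eq_or_lt with hk | hk
          · refine j5 D (fun A hA i hi => ?_) fun d hd => hD' d (by simp [hd])
            by_cases hAi : (A, i) = c
            · subst hAi
              rw [c₂, hk]
            · have : (A, i) ∉ c :: l := by simp [hAi, hi]
              rw [a₂ A i hAi, hD A hA i this, i4 A hA i this]
          · exact j2.trans (i5 D hD hD' (by push_cast; omega))
        · rw [j3 _ le_rfl, x₂]
    · subst h₁
      refine ⟨hs.congr ?_ ?_ ?_ rfl rfl, ?_, fun r hr => ?_, fun A _ i _ => rfl,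
        fun D hD hD' hk => ?_⟩
      · simp [setReg, show 0 ≠ 10 + l.length by omega]
      · simp [setReg, show 2 ≠ 10 + l.length by omega]
      · simp [setReg, show 3 ≠ 10 + l.length by omega]
      · simp [setReg, show 2 ≠ 10 + l.length by omega]
      · simp only [List.length_cons] at hr
        simp [setReg, show r ≠ 10 + l.length by omega, show r ≠ 5 by omega]
      -- Before the first round nothing is claimed: no admissible content reaches n + 1.
      · have := hD' c (by simp)
        push_cast at hk
        omega
    · simp [h₁, setReg]
    · simp only [cost, List.length_cons, forCellsTime]
      have : 2 + forCellsTime n T l.length + 3 = forCellsTime n T l.length + 5 := by omega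
      rw [this]
      omega
    · obtain ⟨h1, h2, h3, h4, h5⟩ := h
      exact ⟨h1, h2, h3, h4, fun D hD hD' => h5 D hD hD' (by simpa using (hD' c (by simp)).1)⟩

/-- The whole program. -/
def OracleProgram.solver (K : ℕ) (l : List Cell) : OracleProgram :=
  seq computeBig (forCells (tryCandidate K) l)

theorem achieves_solver {S : Set (Fin n → ℤ)} (hS : IsIndependenceSystem S)
    (hlin : IsLinearOptimizationOracle S lin) {f : ℤ → ℝ} (hcmp : IsComparisonOracle f cmp)
    (w : Fin n → ℤ) (K : ℕ) (l : List Cell) (hl : ∀ c ∈ l, c.1 ∈ ({3, 4, 5} : Finset ℕ)) :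
    Achieves lin cmp (solver K l) (init w)
      (n * 5 + 4 + forCellsTime n (n * 30 + (K * 3 + 16)) l.length) fun s =>
      s.getVec n 1 ∈ S ∧ ∀ D : ℕ → ℤ → ℤ, (∀ A i, (A, i) ∉ l → D A i = 0) →
        (∀ c ∈ l, 0 ≤ D c.1 c.2 ∧ D c.1 c.2 ≤ n) →
        f (totalWeight w (s.getVec n 1)) ≤ f (totalWeight w (candidate lin w K D)) := by
  have hw : ∀ j : Fin n, (init w).arr 0 ((j : ℕ) : ℤ) = w j := by
    intro j
    simp [init, setVec]
  refine Achieves.seq (achieves_computeBig (init w) (by simp [init, setVec])) fun s ⟨k, h3⟩ =>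
    Achieves.mono (achieves_forCells (w := w) (achieves_tryCandidate hS hlin hcmp K) l hl s
      ⟨?_, ?_, ?_, ?_, ?_⟩) le_rfl fun s' h => ?_
  · rw [k.1 0 (by decide)]
    simp [init, setVec]
  · rw [h3, Finset.sum_range]
    simp only [hw]
  · funext j
    rw [getVec, k.2 0 (by simp), hw]
  -- The cleared array 1 is the zero vector, which lies below any feasible x.
  · obtain ⟨x, hx⟩ := hS.nonempty
    refine hS.down_closed _ x (fun j => Or.inl ?_) (fun j => ?_) hx
    · simp [getVec, k.2 1, init, setVec]
    · rcases hS.zeroOne x hx j with h | h <;> simp [getVec, k.2 1, init, setVec, h]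
  · rw [k.1 2 (by decide)]
    simp [getVec, k.2 1, init, setVec, totalWeight]
  · refine ⟨h.1.mem, fun D hD hD' => ?_⟩
    rw [← h.1.value]
    refine h.2.2.2.2 D (fun A hA i hi => ?_) hD'
    rw [hD A i hi, k.2 A (by simp)]
    have : A ≠ 0 := by
      rintro rfl
      simp at hA
    simp [init, setVec, this]

end

/-! ### Gaps of the semigroup generated by some of the weights -/

/-- The multiples of the greatest common divisor of the `a i` with `i ∈ I` that are not nonnegative
integer combinations of these `a i`. -/
def relativeGaps {p : ℕ} (a : Fin p → ℕ) (I : Finset (Fin p)) : Set ℕ :=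
  {d | I.gcd a ∣ d ∧ ¬ ∃ c : Fin p → ℕ, d = ∑ i ∈ I, c i * a i}

theorem exists_sum_mul_eq_gcd {ι : Type*} [DecidableEq ι] (a : ι → ℕ) (I : Finset ι) :
    ∃ z : ι → ℤ, ((I.gcd a : ℕ) : ℤ) = ∑ i ∈ I, z i * a i := by
  induction I using Finset.induction_on with
  | empty => exact ⟨0, by simp⟩
  | insert i I hi ih =>
    obtain ⟨z, hz⟩ := ih
    refine ⟨fun j => if j = i then Nat.gcdA (a i) (I.gcd a) else Nat.gcdB (a i) (I.gcd a) * z j, ?_⟩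
    rw [Finset.gcd_insert, Finset.sum_insert hi, gcd_eq_nat_gcd, Nat.gcd_eq_gcd_ab]
    simp only [if_true]
    rw [mul_comm (a i : ℤ), mul_comm ((I.gcd a : ℕ) : ℤ), hz, Finset.mul_sum]
    congr 1
    refine Finset.sum_congr rfl fun j hj => ?_
    have hji : j ≠ i := fun h => hi (h ▸ hj)
    simp only [if_neg hji, mul_assoc]

/-- Bézout writes a multiple of the gcd as an integer combination. All coefficients but that of one
`i₀` are reduced modulo `a i₀`, the difference being absorbed by `i₀`. The reduced terms sum to at
most (|I| - 1)A², so from there on the coefficient of `i₀` is nonnegative too. -/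
theorem lt_of_mem_relativeGaps {p : ℕ} {a : Fin p → ℕ} (ha : ∀ i, 0 < a i) {A : ℕ}
    (hA : ∀ i, a i ≤ A) {I : Finset (Fin p)} {d : ℕ} (hd : d ∈ relativeGaps a I) :
    d < (I.card - 1) * (A * A) := by
  obtain ⟨⟨q, rfl⟩, hc⟩ := hd
  by_contra! hle
  apply hc
  -- For empty I the gcd is 0, so the number is 0, the empty sum.
  rcases I.eq_empty_or_nonempty with rfl | ⟨i₀, hi₀⟩
  · exact ⟨0, by simp⟩
  obtain ⟨z, hz⟩ := exists_sum_mul_eq_gcd a I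
  have hpos : (0 : ℤ) < a i₀ := by exact_mod_cast ha i₀
  set J := I.erase i₀ with hJ
  set c : Fin p → ℤ := fun i => (z i * q) % a i₀ with hcdef
  have hc0 : ∀ i, 0 ≤ c i := fun i => Int.emod_nonneg _ hpos.ne'
  have hcA : ∀ i, c i < a i₀ := fun i => Int.emod_lt_of_pos _ hpos
  have hdvd : (a i₀ : ℤ) ∣ ((I.gcd a * q : ℕ) : ℤ) - ∑ i ∈ J, c i * a i := by
    have e : ((I.gcd a * q : ℕ) : ℤ) - ∑ i ∈ J, c i * a i =
        a i₀ * (z i₀ * q) + ∑ i ∈ J, (z i * q - c i) * a i := by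
      push_cast
      rw [hz, ← Finset.add_sum_erase I _ hi₀, add_mul, Finset.sum_mul]
      simp only [sub_mul, Finset.sum_sub_distrib, mul_right_comm _ (q : ℤ)]
      ring_nf
      simp only [hJ]
      ring
    rw [e]
    refine dvd_add (dvd_mul_right _ _) (Finset.dvd_sum fun i _ => Dvd.dvd.mul_right ?_ _)
    exact Int.dvd_self_sub_emod
  obtain ⟨m, hm⟩ := hdvd
  have hsum : ∑ i ∈ J, c i * a i ≤ ((J.card * (A * A) : ℕ) : ℤ) := by
    push_cast
    rw [← nsmul_eq_mul]
    refine Finset.sum_le_card_nsmul _ _ _ fun i _ => ?_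
    have h1 : c i ≤ A := (hcA i).le.trans (by exact_mod_cast hA i₀)
    have h2 : (a i : ℤ) ≤ A := by exact_mod_cast hA i
    exact mul_le_mul h1 h2 (by positivity) (by positivity)
  have hcard : J.card = I.card - 1 := Finset.card_erase_of_mem hi₀
  rw [← hcard] at hle
  have hm0 : 0 ≤ m := by
    by_contra! h
    have : (a i₀ : ℤ) * m < 0 := mul_neg_of_pos_of_neg hpos h
    have : ((J.card * (A * A) : ℕ) : ℤ) ≤ ((I.gcd a * q : ℕ) : ℤ) := by exact_mod_cast hle
    linarith
  obtain ⟨e, he₀, he⟩ : ∃ e : Fin p → ℕ, (e i₀ : ℤ) = m ∧ ∀ i ∈ J, (e i : ℤ) = c i := by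
    refine ⟨fun i => if i = i₀ then m.toNat else (c i).toNat, by simp [hm0], fun i hi => ?_⟩
    simp only [if_neg (Finset.ne_of_mem_erase hi), Int.toNat_of_nonneg (hc0 i)]
  refine ⟨e, ?_⟩
  zify
  rw [← Finset.add_sum_erase I _ hi₀, ← hJ, Finset.sum_congr rfl fun i hi => by rw [he i hi], he₀]
  push_cast at hm
  linarith

theorem relativeGaps_finite {p : ℕ} {a : Fin p → ℕ} (ha : ∀ i, 0 < a i) (I : Finset (Fin p)) :
    (relativeGaps a I).Finite :=
  (Set.finite_lt_nat _).subset fun _ hd =>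
    lt_of_mem_relativeGaps ha (fun i => Finset.le_sup (f := a) (Finset.mem_univ i)) hd

/-- A power with exponent |I| is wanted because it is a product over the coordinates of a pattern.
-/
theorem relativeGaps_ncard_le {p : ℕ} {a : Fin p → ℕ} (ha : ∀ i, 0 < a i)
    (hinj : Function.Injective a) {A : ℕ} (hA : ∀ i, a i ≤ A) (I : Finset (Fin p)) :
    (relativeGaps a I).ncard ≤ A ^ I.card := by
  have h : relativeGaps a I ⊆ ↑(Finset.range ((I.card - 1) * (A * A))) := fun d hd => by
    simpa using lt_of_mem_relativeGaps ha hA hd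
  have h' := Set.ncard_le_ncard h (Finset.finite_toSet _)
  rw [Set.ncard_coe_finset, Finset.card_range] at h'
  refine h'.trans ?_
  rcases Nat.lt_or_ge I.card 2 with hI | hI
  · simp [show I.card - 1 = 0 by omega]
  obtain ⟨k, hk⟩ := Nat.exists_eq_add_of_le hI
  -- Two distinct positive integers are at most A.
  have hA2 : 2 ≤ A := by
    have := Finset.card_le_card_of_injOn (s := I) (t := Finset.Icc 1 A) a
      (fun i _ => by simpa using ⟨ha i, hA i⟩) hinj.injOn
    simp at this
    omega
  have : k + 1 ≤ A ^ k := (Nat.lt_two_pow_self (n := k)).trans_le (Nat.pow_le_pow_left hA2 k)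
  rw [hk, show 2 + k - 1 = k + 1 by omega, pow_add, pow_two, mul_comm (A * A)]
  exact Nat.mul_le_mul_right _ this

theorem relativeGaps_eq_empty_of_card_le_one {p : ℕ} {a : Fin p → ℕ} (ha : ∀ i, 0 < a i)
    {I : Finset (Fin p)} (hI : I.card ≤ 1) : relativeGaps a I = ∅ := by
  refine Set.eq_empty_of_forall_notMem fun d hd => ?_
  have := lt_of_mem_relativeGaps ha (fun i => Finset.le_sup (f := a) (Finset.mem_univ i)) hd
  simp [show I.card - 1 = 0 by omega] at this

theorem relativeGaps_eq_empty_of_dvd {p : ℕ} {a : Fin p → ℕ} {I : Finset (Fin p)} {i₀ : Fin p}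
    (hi₀ : i₀ ∈ I) (h : ∀ i ∈ I, a i₀ ∣ a i) : relativeGaps a I = ∅ := by
  refine Set.eq_empty_of_forall_notMem fun d hd => hd.2 ?_
  obtain ⟨q, rfl⟩ := (Finset.dvd_gcd h).trans hd.1
  exact ⟨Pi.single i₀ q, by simp [Pi.single_apply, hi₀, mul_comm]⟩

theorem IsDivisibleTuple.dvd {p : ℕ} {a : Fin p → ℕ} (h : IsDivisibleTuple a) {i j : Fin p}
    (hij : i ≤ j) : a i ∣ a j := by
  obtain ⟨k, hk⟩ := Nat.exists_eq_add_of_le (Fin.le_def.1 hij)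
  induction k generalizing j with
  | zero => rw [Fin.ext (hk.trans (add_zero _))]
  | succ k ih =>
    have hlt := j.2
    exact (ih (j := ⟨i + k, by omega⟩) (Fin.le_def.2 (by simp)) rfl).trans
      (h _ _ (by simp only [hk]; omega))

theorem IsDivisibleTuple.relativeGaps_eq_empty {p : ℕ} {a : Fin p → ℕ} (ha : ∀ i, 0 < a i)
    (h : IsDivisibleTuple a) (I : Finset (Fin p)) : relativeGaps a I = ∅ := by
  rcases I.eq_empty_or_nonempty with rfl | hI
  · exact relativeGaps_eq_empty_of_card_le_one ha (by simp)
  · exact relativeGaps_eq_empty_of_dvd (I.min'_mem hI) fun i hi => h.dvd (I.min'_le i hi)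

theorem relativeGaps_univ {p : ℕ} {a : Fin p → ℕ} (h : Finset.univ.gcd a = 1) :
    relativeGaps a Finset.univ = gapSet a := by
  ext d
  simp [relativeGaps, gapSet, h]

/-! ### The exchange argument -/

/-- If `ν` can be subtracted from `l` without the result becoming small, then some combination
of the same value is bounded by `l`. -/
theorem exists_le_of_sum_add_sum_eq {ι : Type*} [DecidableEq ι] {a : ι → ℕ} {I : Finset ι} {A : ℕ}
    (ha : ∀ i ∈ I, 0 < a i) (hA : ∀ i ∈ I, a i ≤ A) {κ l : ι → ℕ} (hκ : ∀ i ∈ I, A ≤ κ i)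
    (hl : ∀ i ∈ I, A ≤ l i) (ν : ι → ℕ)
    (h : ∑ i ∈ I, κ i * a i + ∑ i ∈ I, ν i * a i = ∑ i ∈ I, l i * a i) :
    ∃ ν' : ι → ℕ, (∀ i ∈ I, ν' i ≤ l i) ∧ ∑ i ∈ I, ν' i * a i = ∑ i ∈ I, ν i * a i := by
  -- Induction on the total excess of ν over l; the subtraction is truncated.
  induction hN : ∑ i ∈ I, (ν i - l i) using Nat.strong_induction_on generalizing ν with
  | _ N ih =>
  by_cases hall : ∀ i ∈ I, ν i ≤ l i
  · exact ⟨ν, hall, rfl⟩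
  push Not at hall
  obtain ⟨i, hi, hlt⟩ := hall
  -- Some other j has room for `a i` more copies: otherwise κ + ν would be at least l everywhere on
  -- I, because κ ≥ A ≥ `a i`, and larger at i, contradicting `h`.
  have hj : ∃ j ∈ I, j ≠ i ∧ ν j + a i ≤ l j := by
    by_contra! hno
    have : ∑ k ∈ I, l k * a k < ∑ k ∈ I, (κ k * a k + ν k * a k) := by
      refine Finset.sum_lt_sum (fun k hk => ?_) ⟨i, hi, ?_⟩
      · rw [← add_mul]
        refine Nat.mul_le_mul_right _ ?_
        by_cases hki : k = i
        · subst hki; omega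
        · have := hno k hk hki
          have := hκ k hk
          have := hA i hi
          omega
      · rw [← add_mul]
        exact Nat.mul_lt_mul_of_pos_right (by omega) (ha i hi)
    rw [Finset.sum_add_distrib] at this
    omega
  obtain ⟨j, hj, hji, hjl⟩ := hj
  have hij : a j ≤ ν i := (hA j hj).trans ((hl i hi).trans hlt.le)
  -- Trade `a j` copies of i for `a i` copies of j. The sum is unchanged, the excess at i drops and
  -- none arises at j.
  set ν' : ι → ℕ := fun k => ν k + (if k = j then a i else 0) - (if k = i then a j else 0) with hν'
  have hsum : ∑ k ∈ I, ν' k * a k = ∑ k ∈ I, ν k * a k := by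
    have e : ∑ k ∈ I, (ν' k * a k + (if k = i then a j * a k else 0)) =
        ∑ k ∈ I, (ν k * a k + (if k = j then a i * a k else 0)) := by
      refine Finset.sum_congr rfl fun k _ => ?_
      by_cases hki : k = i
      · subst hki
        simp only [hν', if_neg hji.symm, add_zero, if_true, ← add_mul]
        rw [Nat.sub_add_cancel hij]
      · by_cases hkj : k = j
        · simp [hν', hkj, hji, add_mul]
        · simp [hν', hki, hkj]
    rw [Finset.sum_add_distrib, Finset.sum_add_distrib, Finset.sum_ite_eq' I i,
      Finset.sum_ite_eq' I j, if_pos hi, if_pos hj, mul_comm (a i)] at e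
    omega
  have hdec : ∑ k ∈ I, (ν' k - l k) < N := by
    rw [← hN]
    refine Finset.sum_lt_sum (fun k hk => ?_) ⟨i, hi, ?_⟩
    · by_cases hkj : k = j
      · simp [hν', hkj, hji, hjl]
      · simp only [hν', hkj, if_false]
        omega
    · have := ha j hj
      simp only [hν', if_neg hji.symm, if_true]
      omega
  obtain ⟨ν'', h1, h2⟩ := ih _ hdec ν' (by rw [hsum, h]) rfl
  exact ⟨ν'', h1, h2.trans hsum⟩

/-! ### The weights of the candidates -/

/-- The indices of the nonzero entries of a `0/1` vector. -/
def oneSet {n : ℕ} (x : Fin n → ℤ) : Finset (Fin n) := Finset.univ.filter fun j => x j = 1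

theorem mem_oneSet {n : ℕ} {x : Fin n → ℤ} {j : Fin n} : j ∈ oneSet x ↔ x j = 1 := by
  simp [oneSet]

/-- The number of indices of type `i` of the nonzero entries of `x`. -/
def typeCount {n p : ℕ} (τ : Fin n → Fin p) (x : Fin n → ℤ) (i : Fin p) : ℕ :=
  ((oneSet x).filter fun j => τ j = i).card

theorem IsZeroOne.eq_zero {n : ℕ} {x : Fin n → ℤ} (hx : IsZeroOne x) {j : Fin n}
    (hj : j ∉ oneSet x) : x j = 0 :=
  (hx j).resolve_right fun h => hj (mem_oneSet.2 h)

theorem totalWeight_eq_sum {n p : ℕ} {a : Fin p → ℕ} {w : Fin n → ℤ} {τ : Fin n → Fin p}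
    (hτ : ∀ j, w j = a (τ j)) {x : Fin n → ℤ} (hx : IsZeroOne x) :
    totalWeight w x = ((∑ i, typeCount τ x i * a i : ℕ) : ℤ) := by
  have h1 : totalWeight w x = ∑ j ∈ oneSet x, w j := by
    rw [oneSet, Finset.sum_filter, totalWeight]
    refine Finset.sum_congr rfl fun j _ => ?_
    rcases hx j with h | h <;> simp [h]
  rw [h1, ← Finset.sum_fiberwise (oneSet x) τ]
  push_cast
  refine Finset.sum_congr rfl fun i _ => ?_
  rw [Finset.sum_congr rfl (g := fun _ => (a i : ℤ)) fun j hj => by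
    rw [hτ, (Finset.mem_filter.1 hj).2], Finset.sum_const, typeCount, nsmul_eq_mul]

/-- Discrete intermediate values: raising the cutoff by one adds at most one element. So a cutoff
can keep any desired number of ones of a type. -/
theorem exists_card_filter_lt_eq {n : ℕ} (X : Finset (Fin n)) {k : ℕ} (hk : k ≤ X.card) :
    ∃ u ≤ n, (X.filter fun j : Fin n => (j : ℕ) < u).card = k := by
  have key : ∀ m, k ≤ (X.filter fun j : Fin n => (j : ℕ) < m).card →
      ∃ u ≤ m, (X.filter fun j : Fin n => (j : ℕ) < u).card = k := by
    intro m
    induction m with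
    | zero => intro h; exact ⟨0, le_rfl, by simpa using h.antisymm' (by simp)⟩
    | succ m ih =>
      intro h
      rcases Nat.lt_or_ge (X.filter fun j : Fin n => (j : ℕ) < m).card k with hlt | hge
      · refine ⟨m + 1, le_rfl, le_antisymm ?_ h⟩
        have : (X.filter fun j : Fin n => (j : ℕ) < m + 1) ⊆ (X.filter fun j : Fin n => (j : ℕ) < m) ∪
            (X.filter fun j : Fin n => (j : ℕ) = m) := by
          intro j
          simp only [Finset.mem_filter, Finset.mem_union]
          rintro ⟨hj, hjm⟩
          rcases Nat.lt_succ_iff_lt_or_eq.1 hjm with h | h <;> simp [hj, h]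
        have h1 : (X.filter fun j : Fin n => (j : ℕ) = m).card ≤ 1 :=
          Finset.card_le_one.2 fun i hi j hj => Fin.ext
            ((Finset.mem_filter.1 hi).2.trans (Finset.mem_filter.1 hj).2.symm)
        have h2 := (Finset.card_le_card this).trans (Finset.card_union_le _ _)
        omega
      · obtain ⟨u, hu, h⟩ := ih hge
        exact ⟨u, hu.trans m.le_succ, h⟩
  refine key n ?_
  rwa [Finset.filter_true_of_mem fun (j : Fin n) _ => j.2]

/-- A maximizer of a linear function with large coefficients `B` on `T` and `-B` outside `T ∪ L`
contains `T`, is contained in `T ∪ L`, and has maximal weight among the feasible vectors with these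
properties. -/
theorem forced_of_isMax {n : ℕ} {S : Set (Fin n → ℤ)} (hS : ∀ x ∈ S, IsZeroOne x) {w : Fin n → ℤ}
    (hw : ∀ j, 0 ≤ w j) {T : Finset (Fin n)} {L : Fin n → Prop} {c : Fin n → ℤ}
    (hcT : ∀ j ∈ T, c j = 1 + ∑ i, w i) (hcL : ∀ j ∉ T, L j → c j = w j)
    (hcN : ∀ j ∉ T, ¬ L j → c j = -(1 + ∑ i, w i)) {x z : Fin n → ℤ} (hx : x ∈ S)
    (hxT : T ⊆ oneSet x) (hxL : ∀ j ∈ oneSet x, ¬ L j → j ∈ T) (hz : z ∈ S)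
    (hmax : totalWeight c x ≤ totalWeight c z) :
    T ⊆ oneSet z ∧ (∀ j ∈ oneSet z, ¬ L j → j ∈ T) ∧ totalWeight w x ≤ totalWeight w z := by
  set B := 1 + ∑ i, w i with hB
  have hB0 : 0 < B := by
    have := Finset.sum_nonneg fun j (_ : j ∈ Finset.univ) => hw j
    omega
  set t : Fin n → ℤ := fun j => if j ∈ T then B else 0 with ht
  have good : ∀ y ∈ S, T ⊆ oneSet y → (∀ j ∈ oneSet y, ¬ L j → j ∈ T) → ∀ j,
      c j * y j = w j * y j + (t j - if j ∈ T then w j else 0) := by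
    intro y hy hyT hyL j
    by_cases hj : j ∈ T
    · have := mem_oneSet.1 (hyT hj)
      simp [ht, hj, hcT j hj, this]
    · by_cases hyj : j ∈ oneSet y
      · have hLj : L j := by
          by_contra h
          exact hj (hyL j hyj h)
        simp [ht, hj, hcL j hj hLj]
      · simp [ht, hj, (hS y hy).eq_zero hyj]
  have low : ∑ j, t j ≤ totalWeight c x := by
    refine Finset.sum_le_sum fun j _ => ?_
    rw [good x hx hxT hxL]
    by_cases hj : j ∈ T
    · simp [hj, mem_oneSet.1 (hxT hj)]
    · have : 0 ≤ x j := by rcases hS x hx j with h | h <;> simp [h]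
      simpa [hj] using mul_nonneg (hw j) this
  -- Each coordinate of z gains at most `w j` over `t j`, altogether less than B. So losing B at a
  -- single index makes z worse than x.
  have high : ∀ j₀, c j₀ * z j₀ ≤ t j₀ - B → False := by
    intro j₀ h₀
    have : totalWeight c z ≤ ∑ j, (t j + w j - if j = j₀ then B else 0) := by
      refine Finset.sum_le_sum fun j _ => ?_
      by_cases hj : j = j₀
      · subst hj
        rw [if_pos rfl]
        linarith [hw j]
      · rw [if_neg hj, sub_zero]
        have hwj := hw j
        by_cases hjT : j ∈ T
        · rcases hS z hz j with h | h <;> simp only [h, ht, hjT, if_true, hcT j hjT] <;> omega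
        · by_cases hL : L j
          · rcases hS z hz j with h | h <;> simp only [h, ht, hjT, if_false, hcL j hjT hL] <;> omega
          · rcases hS z hz j with h | h <;> simp only [h, ht, hjT, if_false, hcN j hjT hL] <;> omega
    rw [Finset.sum_sub_distrib, Finset.sum_add_distrib, Finset.sum_ite_eq' Finset.univ j₀,
      if_pos (Finset.mem_univ _)] at this
    omega
  have hzT : T ⊆ oneSet z := by
    intro j hj
    by_contra hjz
    refine high j ?_
    simp [ht, hj, (hS z hz).eq_zero hjz]
  have hzL : ∀ j ∈ oneSet z, ¬ L j → j ∈ T := by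
    intro j hj hL
    by_contra hjT
    refine high j ?_
    simp [ht, hjT, mem_oneSet.1 hj, hcN j hjT hL]
  refine ⟨hzT, hzL, ?_⟩
  -- For x and z alike, the objective is now the weight plus the same constant.
  unfold totalWeight at hmax ⊢
  rw [Finset.sum_congr rfl fun j _ => good x hx hxT hxL j,
    Finset.sum_congr rfl fun j _ => good z hz hzT hzL j, Finset.sum_add_distrib,
    Finset.sum_add_distrib] at hmax
  omega

/-! ### Realizing all queries and truncations -/

/-- The cells for the bounds on the indices, by weight, and for the list of forced indices. -/
def solverCells {p : ℕ} (a : Fin p → ℕ) (K : ℕ) : List Cell :=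
  (List.ofFn fun i => ((3, (a i : ℤ)) : Cell)) ++
    ((List.ofFn fun k : Fin K => ((4, ((k : ℕ) : ℤ)) : Cell)) ++
      List.ofFn fun i => ((5, (a i : ℤ)) : Cell))

theorem mem_solverCells {p : ℕ} {a : Fin p → ℕ} {K : ℕ} {c : Cell} :
    c ∈ solverCells a K ↔ (∃ i, ((3, (a i : ℤ)) : Cell) = c) ∨
      (∃ k : Fin K, ((4, ((k : ℕ) : ℤ)) : Cell) = c) ∨ ∃ i, ((5, (a i : ℤ)) : Cell) = c := by
  simp [solverCells, List.mem_ofFn]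

/-- The total weights of the solutions that the program considers. -/
def candidateWeights {n p : ℕ} (lin : (Fin n → ℤ) → (Fin n → ℤ)) (a : Fin p → ℕ) (w : Fin n → ℤ)
    (K : ℕ) : Set ℤ :=
  {v | ∃ D : ℕ → ℤ → ℤ, (∀ A i, (A, i) ∉ solverCells a K → D A i = 0) ∧
    (∀ c ∈ solverCells a K, 0 ≤ D c.1 c.2 ∧ D c.1 c.2 ≤ n) ∧
    totalWeight w (candidate lin w K D) = v}

section

open Classical in
/-- Every vector of bounds and every small set of forced indices is tried. -/
theorem exists_arrays {n p : ℕ} {a : Fin p → ℕ} (hinj : Function.Injective a) {K : ℕ}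
    (I : Finset (Fin p)) {T : Finset (Fin n)} (hT : T.card ≤ K) {u : Fin p → ℕ}
    (hu : ∀ i, u i ≤ n) :
    ∃ D : ℕ → ℤ → ℤ, (∀ A i, (A, i) ∉ solverCells a K → D A i = 0) ∧
      (∀ c ∈ solverCells a K, 0 ≤ D c.1 c.2 ∧ D c.1 c.2 ≤ n) ∧
      (∀ i, D 3 (a i) = if i ∈ I then (n : ℤ) else 0) ∧ (∀ i, D 5 (a i) = u i) ∧
      ∀ j : Fin n, (∃ k < K, D 4 (k : ℤ) = (j : ℕ)) ↔ j ∈ T := by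
  have hinj' : ∀ i i' : Fin p, (a i : ℤ) = a i' → i = i' := fun i i' h =>
    hinj (by exact_mod_cast h)
  -- Unused slots are padded with n, which is not an index and so forces nothing.
  set g : ℕ → ℕ := fun k => (T.toList.map fun j : Fin n => (j : ℕ)).getD k n with hg
  have hgn : ∀ k, g k ≤ n := by
    intro k
    rw [hg]
    dsimp only
    rcases Nat.lt_or_ge k (T.toList.map fun j : Fin n => (j : ℕ)).length with h | h
    · rw [List.getD_eq_getElem _ _ h, List.getElem_map]
      exact (T.toList[k]'(by simpa using h)).2.le
    · rw [List.getD_eq_default _ _ h]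
  set E : Cell → ℤ := fun c =>
    if c.1 = 3 then (if ∃ i ∈ I, (a i : ℤ) = c.2 then (n : ℤ) else 0)
    else if c.1 = 4 then ((g c.2.toNat : ℕ) : ℤ)
    else if h : ∃ i, (a i : ℤ) = c.2 then ((u h.choose : ℕ) : ℤ) else 0 with hE
  have hE3 : ∀ i, E (3, (a i : ℤ)) = if i ∈ I then (n : ℤ) else 0 := by
    intro i
    have : (∃ i' ∈ I, (a i' : ℤ) = a i) ↔ i ∈ I :=
      ⟨fun ⟨i', h, e⟩ => hinj' _ _ e ▸ h, fun h => ⟨i, h, rfl⟩⟩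
    simp only [hE, if_true, this]
  have hE4 : ∀ k : ℕ, E (4, (k : ℤ)) = (g k : ℤ) := by
    intro k
    simp [hE]
  have hE5 : ∀ i, E (5, (a i : ℤ)) = u i := by
    intro i
    have h : ∃ i', (a i' : ℤ) = a i := ⟨i, rfl⟩
    have e : h.choose = i := hinj' _ _ h.choose_spec
    simp only [hE, dif_pos h, e]
    simp
  have m3 : ∀ i, ((3, (a i : ℤ)) : Cell) ∈ solverCells a K := fun i =>
    mem_solverCells.2 (Or.inl ⟨i, rfl⟩)
  have m4 : ∀ k < K, ((4, (k : ℤ)) : Cell) ∈ solverCells a K := fun k hk =>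
    mem_solverCells.2 (Or.inr (Or.inl ⟨⟨k, hk⟩, rfl⟩))
  have m5 : ∀ i, ((5, (a i : ℤ)) : Cell) ∈ solverCells a K := fun i =>
    mem_solverCells.2 (Or.inr (Or.inr ⟨i, rfl⟩))
  obtain ⟨D, hD0, hDE⟩ : ∃ D : ℕ → ℤ → ℤ, (∀ A i, (A, i) ∉ solverCells a K → D A i = 0) ∧
      ∀ c ∈ solverCells a K, D c.1 c.2 = E c :=
    ⟨fun A i => if (A, i) ∈ solverCells a K then E (A, i) else 0, fun A i h => if_neg h,
      fun c hc => if_pos hc⟩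
  refine ⟨D, hD0, fun c hc => ?_, fun i => (hDE _ (m3 i)).trans (hE3 i),
    fun i => (hDE _ (m5 i)).trans (hE5 i), fun j => ⟨?_, fun hj => ?_⟩⟩
  · rw [hDE c hc]
    rcases mem_solverCells.1 hc with ⟨i, rfl⟩ | ⟨k, rfl⟩ | ⟨i, rfl⟩
    · rw [hE3]
      split_ifs <;> simp
    · rw [hE4]
      exact ⟨by positivity, by exact_mod_cast hgn k⟩
    · rw [hE5]
      exact ⟨by positivity, by exact_mod_cast hu i⟩
  · rintro ⟨k, hk, h⟩
    rw [hDE _ (m4 k hk), hE4] at h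
    have h' : g k = j := by exact_mod_cast h
    rcases Nat.lt_or_ge k (T.toList.map fun j : Fin n => (j : ℕ)).length with hkl | hkl
    · rw [hg] at h'
      dsimp only at h'
      rw [List.getD_eq_getElem _ _ hkl] at h'
      have := List.getElem_mem hkl
      rw [h', List.mem_map] at this
      obtain ⟨j', hj', e⟩ := this
      rw [← Fin.ext e]
      simpa using hj'
    · rw [hg] at h'
      dsimp only at h'
      rw [List.getD_eq_default _ _ hkl] at h'
      exact absurd h' j.2.ne'
  · have hj' : (j : ℕ) ∈ T.toList.map fun j : Fin n => (j : ℕ) :=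
      List.mem_map.2 ⟨j, by simpa using hj, rfl⟩
    obtain ⟨k, hk, e⟩ := List.getElem_of_mem hj'
    have hkK : k < K := by
      simp only [List.length_map, Finset.length_toList] at hk
      omega
    refine ⟨k, hkK, ?_⟩
    rw [hDE _ (m4 k hkK), hE4, hg]
    dsimp only
    rw [List.getD_eq_getElem _ _ hk, e]

end

/-- For every feasible `x` the program finds a feasible `z` of the same pattern, at least the same
weight, and such that it considers all weights of vectors below `z`. -/
theorem exists_dominating {n p : ℕ} {a : Fin p → ℕ} (hinj : Function.Injective a)
    {S : Set (Fin n → ℤ)} {lin : (Fin n → ℤ) → (Fin n → ℤ)} (hS : IsIndependenceSystem S)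
    (hlin : IsLinearOptimizationOracle S lin) {w : Fin n → ℤ} {τ : Fin n → Fin p}
    (hτ : ∀ j, w j = a (τ j)) (A : ℕ) {x : Fin n → ℤ} (hx : x ∈ S) :
    ∃ z ∈ S, (∀ i, min (typeCount τ z i) A = min (typeCount τ x i) A) ∧
      totalWeight w x ≤ totalWeight w z ∧
      ∀ ν : Fin p → ℕ, (∀ i, ν i ≤ typeCount τ z i) →
        ((∑ i, ν i * a i : ℕ) : ℤ) ∈ candidateWeights lin a w (p * A) := by
  have hw : ∀ j, 0 ≤ w j := fun j => by rw [hτ]; positivity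
  -- Force A ones of x of each saturated type, and all its ones of the other types.
  have hT₀ : ∀ i, ∃ T ⊆ (oneSet x).filter (fun j => τ j = i), T.card = min (typeCount τ x i) A :=
    fun i => Finset.exists_subset_card_eq (min_le_left _ _)
  choose T₀ hT₀ hT₀c using hT₀
  set T := Finset.univ.biUnion T₀ with hT
  set I := Finset.univ.filter fun i => A ≤ typeCount τ x i with hI
  have hTi : ∀ i, T.filter (fun j => τ j = i) = T₀ i := by
    intro i
    ext j
    simp only [hT, Finset.mem_filter, Finset.mem_biUnion, Finset.mem_univ, true_and]
    constructor
    · rintro ⟨⟨i', h⟩, rfl⟩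
      rwa [← (Finset.mem_filter.1 (hT₀ i' h)).2] at h
    · exact fun h => ⟨⟨i, h⟩, (Finset.mem_filter.1 (hT₀ i h)).2⟩
  have hTK : T.card ≤ p * A := by
    refine Finset.card_biUnion_le.trans ((Finset.sum_le_card_nsmul _ _ A fun i _ => ?_).trans ?_)
    · rw [hT₀c]
      exact min_le_right _ _
    · simp
  have hxT : T ⊆ oneSet x := Finset.biUnion_subset.2 fun i _ =>
    (hT₀ i).trans (Finset.filter_subset _ _)
  have hfull : ∀ i ∉ I, T₀ i = (oneSet x).filter fun j => τ j = i := by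
    intro i hi
    refine Finset.eq_of_subset_of_card_le (hT₀ i) ?_
    simp only [hI, Finset.mem_filter, Finset.mem_univ, true_and, not_le] at hi
    rw [hT₀c, min_eq_left hi.le]
    exact le_rfl
  have hxL : ∀ j ∈ oneSet x, ¬ τ j ∈ I → j ∈ T := by
    intro j hj hi
    have : j ∈ T₀ (τ j) := by
      rw [hfull _ hi]
      exact Finset.mem_filter.2 ⟨hj, rfl⟩
    exact Finset.mem_biUnion.2 ⟨τ j, Finset.mem_univ _, this⟩
  set c : Fin n → ℤ := fun j =>
    if j ∈ T then 1 + ∑ i, w i else if τ j ∈ I then w j else -(1 + ∑ i, w i) with hc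
  -- The bound n in array 3 admits all indices of a type, the bound 0 none.
  have hquery : ∀ D : ℕ → ℤ → ℤ, (∀ i, D 3 (a i) = if i ∈ I then (n : ℤ) else 0) →
      (∀ j : Fin n, (∃ k < p * A, D 4 (k : ℤ) = (j : ℕ)) ↔ j ∈ T) →
      queryVec w (p * A) D = c := by
    intro D h3 h4
    funext j
    simp only [queryVec, hc, h4]
    congr 1
    rw [hτ, h3]
    by_cases hj : τ j ∈ I <;> simp [hj]
  set z := lin c with hz
  have hzS : z ∈ S := (hlin c).1
  obtain ⟨hzT, hzL, hzw⟩ := forced_of_isMax hS.zeroOne hw (T := T) (L := fun j => τ j ∈ I) (c := c)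
    (fun j hj => by simp [hc, hj]) (fun j hj hL => by simp [hc, hj, hL])
    (fun j hj hL => by simp [hc, hj, hL]) hx hxT hxL hzS ((hlin c).2 x hx)
  refine ⟨z, hzS, fun i => ?_, hzw, fun ν hν => ?_⟩
  · have hsub : T₀ i ⊆ (oneSet z).filter fun j => τ j = i := by
      rw [← hTi]
      exact Finset.filter_subset_filter _ hzT
    by_cases hi : i ∈ I
    · have h1 := Finset.card_le_card hsub
      rw [hT₀c] at h1
      simp only [hI, Finset.mem_filter, Finset.mem_univ, true_and] at hi
      rw [min_eq_right hi] at h1 ⊢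
      exact min_eq_right h1
    -- For an unsaturated type, the ones of z are exactly the forced ones.
    · have : (oneSet z).filter (fun j => τ j = i) = T₀ i := by
        refine Finset.Subset.antisymm (fun j hj => ?_) hsub
        obtain ⟨hjz, rfl⟩ := Finset.mem_filter.1 hj
        rw [← hTi]
        exact Finset.mem_filter.2 ⟨hzL j hjz hi, rfl⟩
      rw [typeCount, this, hfull i hi, typeCount]
  · have hu : ∀ i, ∃ u ≤ n, (((oneSet z).filter fun j => τ j = i).filter
        fun j : Fin n => (j : ℕ) < u).card = ν i := fun i => exists_card_filter_lt_eq _ (hν i)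
    choose u hun hu using hu
    obtain ⟨D, hD, hD', h3, h5, h4⟩ := exists_arrays hinj I hTK hun
    refine ⟨D, hD, hD', ?_⟩
    have hy : candidate lin w (p * A) D = truncVec w D z := by
      rw [candidate, hquery D h3 h4]
    rw [hy, totalWeight_eq_sum hτ (hS.zeroOne _ (truncVec_mem hS w D hzS))]
    congr 1
    refine Finset.sum_congr rfl fun i _ => ?_
    rw [← hu i, typeCount]
    congr 2
    ext j
    simp only [Finset.mem_filter, mem_oneSet, truncVec, hτ, h5]
    constructor
    · rintro ⟨h, rfl⟩
      split_ifs at h with hlt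
      · exact ⟨⟨h, rfl⟩, by exact_mod_cast hlt⟩
      · simp at h
    · rintro ⟨⟨h, rfl⟩, hlt⟩
      rw [if_pos (by exact_mod_cast hlt)]
      exact ⟨h, rfl⟩

theorem IsIndependenceSystem.finite {n : ℕ} {S : Set (Fin n → ℤ)} (hS : IsIndependenceSystem S) :
    S.Finite := by
  refine (Set.Finite.pi' (t := fun _ => ({0, 1} : Set ℤ)) fun _ => Set.toFinite _).subset
    fun x hx j => ?_
  simpa using hS.zeroOne x hx j

/-- The feasible weights that the program does not consider are, pattern by pattern, obtained by
subtracting gaps from the largest weight. -/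
theorem exists_missed_eq_sub {n p : ℕ} {a : Fin p → ℕ} (hinj : Function.Injective a)
    (ha : ∀ i, 0 < a i) {S : Set (Fin n → ℤ)} {lin : (Fin n → ℤ) → (Fin n → ℤ)}
    (hS : IsIndependenceSystem S) (hlin : IsLinearOptimizationOracle S lin) {w : Fin n → ℤ}
    (hw : ∀ j, ∃ i, w j = (a i : ℤ)) {A : ℕ} (hA : ∀ i, a i ≤ A) :
    ∃ M : (Fin p → Fin (A + 1)) → ℤ, ∀ y ∈ S,
      totalWeight w y ∈ candidateWeights lin a w (p * A) ∨
      ∃ μ : Fin p → Fin (A + 1),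
        ∃ d ∈ relativeGaps a (Finset.univ.filter fun i => (μ i : ℕ) = A),
          totalWeight w y = M μ - d := by
  choose τ hτ using hw
  have key : ∀ μ : Fin p → Fin (A + 1), ∃ m : ℤ, ∀ y ∈ S,
      (∀ i, min (typeCount τ y i) A = μ i) →
      totalWeight w y ∈ candidateWeights lin a w (p * A) ∨
        ∃ d ∈ relativeGaps a (Finset.univ.filter fun i => (μ i : ℕ) = A),
          totalWeight w y = m - d := by
    intro μ
    set Sμ := {x ∈ S | ∀ i, min (typeCount τ x i) A = μ i} with hSμ
    rcases Sμ.eq_empty_or_nonempty with h | h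
    · refine ⟨0, fun y hy hyμ => ?_⟩
      have : y ∈ Sμ := ⟨hy, hyμ⟩
      simp [h] at this
    -- As z has the pattern of the heaviest x and weighs no less, it is heaviest as well.
    obtain ⟨x, hxμ, hmax⟩ := Set.exists_max_image Sμ (totalWeight w)
      (hS.finite.subset fun x hx => hx.1) h
    obtain ⟨z, hzS, hzμ, hxz, hz⟩ := exists_dominating hinj hS hlin hτ A hxμ.1
    refine ⟨totalWeight w z, fun y hy hyμ => ?_⟩
    rw [or_iff_not_imp_right]
    intro hgap
    set I := Finset.univ.filter fun i => (μ i : ℕ) = A with hI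
    have hle : totalWeight w y ≤ totalWeight w z := (hmax y ⟨hy, hyμ⟩).trans hxz
    have hin : ∀ i, i ∈ I ↔ (μ i : ℕ) = A := fun i => by simp [hI]
    have hyI : ∀ i ∈ I, A ≤ typeCount τ y i := fun i hi => by
      have := hyμ i
      rw [(hin i).1 hi] at this
      exact min_eq_right_iff.1 this
    have hzI : ∀ i ∈ I, A ≤ typeCount τ z i := fun i hi => by
      have := (hzμ i).trans (hxμ.2 i)
      rw [(hin i).1 hi] at this
      exact min_eq_right_iff.1 this
    have hout : ∀ i ∉ I, typeCount τ z i = typeCount τ y i := fun i hi => by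
      have h1 := (hzμ i).trans (hxμ.2 i)
      have h2 := hyμ i
      have h3 : (μ i : ℕ) ≠ A := fun h => hi ((hin i).2 h)
      omega
    have hsplit : ∀ c : Fin p → ℕ, ∑ i, c i * a i =
        ∑ i ∈ I, c i * a i + ∑ i ∈ Finset.univ \ I, c i * a i := fun c => by
      rw [add_comm, Finset.sum_sdiff (Finset.subset_univ I)]
    rw [totalWeight_eq_sum hτ (hS.zeroOne y hy)] at hle hgap ⊢
    rw [totalWeight_eq_sum hτ (hS.zeroOne z hzS)] at hle hgap
    have hrest : ∑ i ∈ Finset.univ \ I, typeCount τ z i * a i =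
        ∑ i ∈ Finset.univ \ I, typeCount τ y i * a i :=
      Finset.sum_congr rfl fun i hi => by rw [hout i (Finset.mem_sdiff.1 hi).2]
    have hle' : ∑ i ∈ I, typeCount τ y i * a i ≤ ∑ i ∈ I, typeCount τ z i * a i := by
      have : ∑ i, typeCount τ y i * a i ≤ ∑ i, typeCount τ z i * a i := by exact_mod_cast hle
      rw [hsplit, hsplit (typeCount τ z), hrest] at this
      omega
    obtain ⟨d, hd⟩ := Nat.exists_eq_add_of_le hle'
    have hdvd : I.gcd a ∣ d := by
      refine (Nat.dvd_add_right (Finset.dvd_sum fun i hi => ?_)).1 (hd ▸ Finset.dvd_sum fun i hi => ?_)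
      · exact (Finset.gcd_dvd hi).mul_left _
      · exact (Finset.gcd_dvd hi).mul_left _
    have hcomb : ∃ c : Fin p → ℕ, d = ∑ i ∈ I, c i * a i := by
      by_contra hno
      refine hgap ⟨d, ⟨hdvd, hno⟩, ?_⟩
      rw [hsplit, hsplit (typeCount τ z), hrest, hd]
      push_cast
      ring
    obtain ⟨c, rfl⟩ := hcomb
    -- Here κ and l are the counts of y and z. Removing the resulting ν from z leaves exactly the
    -- weight of y.
    obtain ⟨ν, hν, hνs⟩ := exists_le_of_sum_add_sum_eq (fun i _ => ha i) (fun i _ => hA i) hyI hzI c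
      hd.symm
    have := hz (fun i => if i ∈ I then typeCount τ z i - ν i else typeCount τ z i) fun i => by
      split_ifs <;> omega
    have e : ∑ i, (if i ∈ I then typeCount τ z i - ν i else typeCount τ z i) * a i =
        ∑ i, typeCount τ y i * a i := by
      rw [hsplit fun i => if i ∈ I then typeCount τ z i - ν i else typeCount τ z i, hsplit,
        ← hrest]
      congr 1
      · have e' : ∑ i ∈ I, (if i ∈ I then typeCount τ z i - ν i else typeCount τ z i) * a i +
            ∑ i ∈ I, ν i * a i = ∑ i ∈ I, typeCount τ z i * a i := by
          rw [← Finset.sum_add_distrib]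
          refine Finset.sum_congr rfl fun i hi => ?_
          rw [if_pos hi, ← add_mul, Nat.sub_add_cancel (hν i hi)]
        omega
      · exact Finset.sum_congr rfl fun i hi => by rw [if_neg (Finset.mem_sdiff.1 hi).2]
    rwa [e] at this
  choose M hM using key
  refine ⟨M, fun y hy => ?_⟩
  refine (hM (fun i => ⟨min (typeCount τ y i) A, by omega⟩) y hy fun i => rfl).imp_right
    fun h => ⟨_, h⟩

/-! ### The approximation constants -/

/-- The total number of gaps over all patterns. A pattern tells for every weight how often it is
used, where `A` stands for `A` times or more. -/
noncomputable def totalGaps {p : ℕ} (a : Fin p → ℕ) (A : ℕ) : ℕ :=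
  ∑ μ : Fin p → Fin (A + 1),
    (relativeGaps a (Finset.univ.filter fun i => (μ i : ℕ) = A)).ncard

/-- The number m of nested loops will depend only on a, so it may enter the degree. -/
theorem exists_polynomial_eval_eq_forCellsTime (c m : ℕ) :
    ∃ q : Polynomial ℕ, ∀ n, q.eval n = forCellsTime n (n * 30 + c) m := by
  induction m with
  | zero => exact ⟨.X * 30 + .C c, fun n => by simp [forCellsTime]⟩
  | succ m ih =>
    obtain ⟨q, hq⟩ := ih
    exact ⟨(.X + 1) * (q + 5) + 3, fun n => by simp [forCellsTime, hq]⟩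

/-- A value better than the output comes from a weight that was not tried, hence from a pair of a
pattern and a gap. -/
theorem isApproximationConstant_totalGaps {p : ℕ} {a : Fin p → ℕ} (h : IsPrimitiveTuple a) {A : ℕ}
    (hA : ∀ i, a i ≤ A) : IsApproximationConstant a (totalGaps a A) := by
  classical
  obtain ⟨q, hq⟩ := exists_polynomial_eval_eq_forCellsTime (p * A * 3 + 16)
    (solverCells a (p * A)).length
  refine ⟨.solver (p * A) (solverCells a (p * A)), .X * 5 + 4 + q, ?_⟩
  intro n S lin w f cmp hS hlin hw hcmp
  have hcells : ∀ c ∈ solverCells a (p * A), c.1 ∈ ({3, 4, 5} : Finset ℕ) := by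
    intro c hc
    rcases mem_solverCells.1 hc with ⟨i, rfl⟩ | ⟨k, rfl⟩ | ⟨i, rfl⟩ <;> simp
  obtain ⟨t, s, hr, ht, hmem, hbest⟩ :=
    achieves_solver hS hlin hcmp w (p * A) (solverCells a (p * A)) hcells
  refine ⟨t, s, hr, ?_, hmem, ?_⟩
  · simpa [hq] using ht
  obtain ⟨M, hM⟩ := exists_missed_eq_sub h.injective h.pos hS hlin hw hA
  set G : (Fin p → Fin (A + 1)) → Finset ℕ := fun μ =>
    (relativeGaps_finite h.pos (Finset.univ.filter fun i => (μ i : ℕ) = A)).toFinset with hG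
  set V : Finset ℝ := Finset.univ.biUnion fun μ => (G μ).image fun d : ℕ => f (M μ - (d : ℤ)) with hV
  have hsub : {v : ℝ | (∃ y ∈ S, f (totalWeight w y) = v) ∧
      v < f (totalWeight w (s.getVec n 1))} ⊆ V := by
    rintro v ⟨⟨y, hy, rfl⟩, hlt⟩
    rcases hM y hy with ⟨D, hD, hD', hDv⟩ | ⟨μ, d, hd, e⟩
    · have := hbest D hD hD'
      rw [hDv] at this
      exact absurd this (not_le.2 hlt)
    · rw [e]
      simp only [hV, Finset.coe_biUnion, Set.mem_iUnion, Finset.mem_coe, Finset.mem_univ,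
        Finset.mem_image]
      exact ⟨μ, trivial, d, by simpa [hG] using hd, rfl⟩
  refine (Set.encard_le_encard hsub).trans ?_
  rw [Set.encard_coe_eq_coe_finsetCard, totalGaps]
  norm_cast
  refine Finset.card_biUnion_le.trans (Finset.sum_le_sum fun μ _ => ?_)
  refine Finset.card_image_le.trans (le_of_eq ?_)
  rw [hG, Set.ncard_eq_toFinset_card _ (relativeGaps_finite h.pos _)]

theorem IsApproximationConstant.mono {p : ℕ} {a : Fin p → ℕ} {r r' : ℕ}
    (h : IsApproximationConstant a r) (hr : r ≤ r') : IsApproximationConstant a r' := by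
  obtain ⟨P, T, hP⟩ := h
  refine ⟨P, T, fun n S lin w f cmp hS hlin hw hcmp => ?_⟩
  obtain ⟨t, s, hrun, ht, hmem, hcard⟩ := hP n S lin w f cmp hS hlin hw hcmp
  exact ⟨t, s, hrun, ht, hmem, hcard.trans (by exact_mod_cast hr)⟩

/-- Bounding each summand by a product with a factor A per saturated coordinate and 1 per other one
makes the sum over patterns factor. A coordinate contributes A once and 1 for each of the A smaller
counts, in total 2A. -/
theorem totalGaps_le {p : ℕ} {a : Fin p → ℕ} (h : IsPrimitiveTuple a) {A : ℕ}
    (hA : ∀ i, a i ≤ A) : totalGaps a A ≤ (2 * A) ^ p := by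
  have hsum : ∑ v : Fin (A + 1), (if (v : ℕ) = A then A else 1) = 2 * A := by
    rw [Fin.sum_univ_castSucc, Finset.sum_congr rfl (g := fun _ => 1) fun v _ => by
      rw [Fin.val_castSucc, if_neg v.2.ne]]
    simp [two_mul]
  have hprod : ∏ _i : Fin p, ∑ v : Fin (A + 1), (if (v : ℕ) = A then A else 1) = (2 * A) ^ p := by
    simp [hsum]
  rw [← hprod, Finset.prod_univ_sum, Fintype.piFinset_univ]
  refine Finset.sum_le_sum fun μ _ => ?_
  rw [Finset.prod_ite, Finset.prod_const, Finset.prod_const_one, mul_one]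
  exact relativeGaps_ncard_le h.pos h.injective hA _

theorem IsDivisibleTuple.totalGaps_eq_zero {p : ℕ} {a : Fin p → ℕ} (ha : ∀ i, 0 < a i)
    (h : IsDivisibleTuple a) (A : ℕ) : totalGaps a A = 0 :=
  Finset.sum_eq_zero fun μ _ => by rw [h.relativeGaps_eq_empty ha, Set.ncard_empty]

theorem gapSet_bddAbove {p : ℕ} {a : Fin p → ℕ} (h : IsPrimitiveTuple a) :
    BddAbove (gapSet a) :=
  relativeGaps_univ h.gcd_eq_one ▸ (relativeGaps_finite h.pos _).bddAbove

theorem ncard_gapSet_le {p : ℕ} {a : Fin p → ℕ} (h : IsPrimitiveTuple a) :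
    (gapSet a).ncard ≤ frobeniusNum a := by
  have hsub : gapSet a ⊆ ↑(Finset.Icc 1 (frobeniusNum a)) := fun d hd => by
    rw [Finset.coe_Icc]
    refine ⟨Nat.one_le_iff_ne_zero.2 ?_, le_csSup (gapSet_bddAbove h) hd⟩
    rintro rfl
    exact hd ⟨0, by simp⟩
  simpa using Set.ncard_le_ncard hsub (Finset.finite_toSet _)

theorem frobeniusNum_le {p : ℕ} {a : Fin p → ℕ} (h : IsPrimitiveTuple a) {A : ℕ}
    (hA : ∀ i, a i ≤ A) : frobeniusNum a ≤ (p - 1) * (A * A) := by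
  refine csSup_le' fun d hd => ?_
  rw [← relativeGaps_univ h.gcd_eq_one] at hd
  simpa using (lt_of_mem_relativeGaps h.pos hA hd).le

theorem IsDivisibleTuple.frobeniusNum_eq_zero {p : ℕ} {a : Fin p → ℕ} (h : IsPrimitiveTuple a)
    (hd : IsDivisibleTuple a) : frobeniusNum a = 0 := by
  rw [frobeniusNum, ← relativeGaps_univ h.gcd_eq_one, hd.relativeGaps_eq_empty h.pos]
  simp

/-- Any pattern except the fully saturated one has at most one saturated weight, hence no gaps. -/
theorem totalGaps_le_frobeniusNum {a : Fin 2 → ℕ} (h : IsPrimitiveTuple a) (A : ℕ) :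
    totalGaps a A ≤ frobeniusNum a := by
  rw [totalGaps, Finset.sum_eq_single fun _ => Fin.last A]
  · simpa [relativeGaps_univ h.gcd_eq_one] using ncard_gapSet_le h
  · intro μ _ hμ
    rw [relativeGaps_eq_empty_of_card_le_one h.pos, Set.ncard_empty]
    have hlt : (Finset.univ.filter fun i => (μ i : ℕ) = A) ⊂ Finset.univ := by
      refine Finset.filter_ssubset.2 ?_
      by_contra! hall
      exact hμ (funext fun i => Fin.ext (hall i (Finset.mem_univ i)))
    have := Finset.card_lt_card hlt
    simp only [Finset.card_univ, Fintype.card_fin] at this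
    omega
  · simp

theorem mainTheorem8 :
    ∃ r : (p : ℕ) → (Fin p → ℕ) → ℕ,
      ∀ (p : ℕ) (a : Fin p → ℕ), IsPrimitiveTuple a →
        IsApproximationConstant a (r p a) ∧
        r p a ≤ (2 * maxEntry a) ^ p ∧
        (IsDivisibleTuple a → r p a = 0) ∧
        (p = 2 → r p a = frobeniusNum a) := by
  -- For p = 2 the gap count may be below the Frobenius number; enlarging the constant is harmless.
  refine ⟨fun p a => if p = 2 then frobeniusNum a else totalGaps a (maxEntry a),
    fun p a h => ?_⟩
  have hA : ∀ i, a i ≤ maxEntry a := fun i => Finset.le_sup (f := a) (Finset.mem_univ i)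
  have happrox := isApproximationConstant_totalGaps h hA
  by_cases hp : p = 2
  · subst hp
    simp only [if_true]
    refine ⟨happrox.mono (totalGaps_le_frobeniusNum h _), ?_, fun hd => hd.frobeniusNum_eq_zero h,
      fun _ => trivial⟩
    refine (frobeniusNum_le h hA).trans ?_
    rw [mul_pow, pow_two (maxEntry a)]
    exact Nat.mul_le_mul_right _ (by norm_num)
  · simp only [if_neg hp]
    exact ⟨happrox, totalGaps_le h hA, fun hd => hd.totalGaps_eq_zero h.pos _, fun h' => absurd h' hp⟩
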